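/- All vector spaces are over $\mathbb C$. For $\mathbb Z_2$-homogeneous $u,v$ of parities $|u|,|v|$ put $\varepsilon_{u,v}=(-1)^{|u||v|}$. **Definitions.** A *vertex Lie superalgebra* is a $\mathbb Z_2$-graded vector space $U=U^0\oplus U^1$ with an even linear operator $D$ and a linear map $u\mapsto Y(u,z)=\sum_{n\ge 0}u_nz^{-n-1}\in z^{-1}(\mathrm{End}\,U)[[z^{-1}]]$ such that: $u_nv=0$ for $n$ sufficiently large; $[D,Y(u,z)]=Y(Du,z)=\frac{d}{dz}Y(u,z)$; $|u_nv|=|u|+|v|$ for homogeneous $u,v$ and $n\ge0$; and, for homogeneous $u,v$, the half skew symmetry $$u_nv=-\varepsilon_{u,v}\sum_{k\ge0}(-1)^{n+k}\frac{D^k}{k!}\,v_{n+k}u\qquad(n\ge0)$$ and the half Jacobi identity $$\sum_{i\ge0}(-1)^i\binom ki\bigl(u_{m+k-i}(v_{n+i}w)-\varepsilon_{u,v}(-1)^k v_{n+k-i}(u_{m+i}w)\bigr)=\sum_{i\ge0}\binom mi(u_{k+i}v)_{m+n-i}w\qquad(*)$$ hold for all $w\in U$ and $k,m,n\ge0$.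 A *vertex superalgebra* is a $\mathbb Z_2$-graded vector space $V$ with a vector $\mathbf 1$ (the vacuum), a linear operator $D$ (the derivation) and a linear map $u\mapsto Y(u,z)=\sum_{n\in\mathbb Z}u_nz^{-n-1}\in(\mathrm{End}\,V)[[z^{-1},z]]$ such that: $u_nv=0$ for $n$ sufficiently large; $[D,Y(u,z)]=Y(Du,z)=\frac{d}{dz}Y(u,z)$; $Y(\mathbf 1,z)=\mathrm{id}_V$; $u_n\mathbf 1=0$ for $n\ge0$ and $u_{-1}\mathbf 1=u$; $|u_nv|=|u|+|v|$ for homogeneous $u,v$ and $n\in\mathbb Z$; and the Jacobi identity holds, i.e. $(*)$ for all homogeneous $u,v\in V$, all $w\in V$ and all $k,m,n\in\mathbb Z$. It is *generated* by a subset $X$ if $V$ is the smallest $\mathbb Z_2$-graded subspace of $V$ that contains $X$ and $\mathbf 1$ and is closed under $D$ and all products $u_nv$, $n\in\mathbb Z$. Let $M$ be a $\mathbb Z_2$-graded vector space with an even operator $D$. Series $a(z),b(z)\in(\mathrm{End}\,M)[[z^{-1},z]]$, homogeneous of parities $|a|,|b|$, are *local to each other* if $(z_1-z_2)^Na(z_1)b(z_2)=(-1)^{|a||b|}(z_1-z_2)^Nb(z_2)a(z_1)$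 for some $N\in\mathbb N$. A homogeneous series $a(z)=\sum_{n\in\mathbb Z} a_nz^{-n-1}$ is a *vertex operator* on $M$ if for every $w\in M$ one has $a_nw=0$ for $n$ sufficiently large, $a(z)$ is local to itself, and $[D,a(z)]=\frac{d}{dz}a(z)$. **Construction.** Let $U$ be a vertex Lie superalgebra and write $u_n=u\otimes q^n\in U\otimes\mathbb C[q,q^{-1}]$. Let $$\mathcal L(U)=\bigl(U\otimes\mathbb C[q,q^{-1}]\bigr)/\mathrm{span}\{(Du)_n+nu_{n-1}\mid u\in U,\ n\in\mathbb Z\},$$ $\mathbb Z_2$-graded with $q$ even, be the Lie superalgebra with bracket $[u_n,v_p]=\sum_{i\ge0}\binom ni(u_iv)_{n+p-i}$ and even derivation $D(u_n)=(Du)_n$, and let $\mathcal L_+(U)=\mathrm{span}\{u_n\mid u\in U,\ n\ge0\}$. Let $\mathcal U(\mathcal L(U))$ be the universal enveloping algebra of $\mathcal L(U)$, and let $$\mathcal V(U)=\mathcal U(\mathcal L(U))\otimes_{\mathcal U(\mathcal L_+(U))}\mathbb C=\mathcal U(\mathcal L(U))/\mathcal U(\mathcal L(U))\mathcal L_+(U)$$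 be the generalized Verma module, with the induced $\mathbb Z_2$-grading, the image $\mathbf 1$ of $1$, and the operator $D$ induced by the extension of $D$ to a derivation of $\mathcal U(\mathcal L(U))$. For $u\in U$ let $Y_{\mathcal V(U)}(u,z)=\sum_{n\in\mathbb Z}u_nz^{-n-1}$, where $u_n\in\mathcal L(U)$ acts on $\mathcal V(U)$ by left multiplication, and let $\kappa_U(u)=u_{-1}\mathbf 1\in\mathcal V(U)$. **Theorem.** For every vertex Lie superalgebra $U$ the following hold. 1. For homogeneous $u\in U$, the series $Y_{\mathcal V(U)}(u,z)$ is a vertex operator on $\mathcal V(U)$ of parity $|u|$, and for homogeneous $u,v\in U$ the series $Y_{\mathcal V(U)}(u,z)$ and $Y_{\mathcal V(U)}(v,z)$ are local to each other. 2. There is exactly one vertex superalgebra structure on the $\mathbb Z_2$-graded space $\mathcal V(U)$ with vacuum $\mathbf 1$ and derivation $D$ such that $Y(\kappa_U(u),z)=Y_{\mathcal V(U)}(u,z)$ for all $u\in U$. This vertex superalgebra is generated by $\{\kappa_U(u)\mid u\in U^0\cup U^1\}$, i.e. by the set of fields $\{Y_{\mathcal V(U)}(u,z)\mid u\in U^0\cup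 U^1\}$. -/

import Mathlib

noncomputable section

namespace VertexLie

/-! ## Signs, formal series of operators, vertex superalgebras -/

/-- The sign `ε = (-1)^{|u||v|}` attached to two parities `|u| = i`, `|v| = j` in `ℤ/2`. -/
def superSign (i j : ZMod 2) : ℂ := (-1) ^ (i.val * j.val)

/-- The space `(End M)[[z⁻¹, z]]`: the function `a : ℤ → End M` stands for the formal series
`a(z) = ∑ₙ aₙ z^{-n-1}`. -/
abbrev FormalSeries (M : Type*) [AddCommGroup M] [Module ℂ M] : Type _ :=
  ℤ → Module.End ℂ M

section VertexSuperalgebra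

variable {M : Type*} [AddCommGroup M] [Module ℂ M]

/-- The series `a(z)` and `b(z)`, homogeneous of parities `i` and `j`, are local to each other:
`(z₁ - z₂)^N a(z₁) b(z₂) = (-1)^{ij} (z₁ - z₂)^N b(z₂) a(z₁)` for some `N ∈ ℕ`. This is the
equality of the coefficients of `z₁^{-m-1} z₂^{-n-1}` for all `m, n ∈ ℤ`. -/
def MutuallyLocal (i j : ZMod 2) (a b : FormalSeries M) : Prop :=
  ∃ N : ℕ, ∀ m n : ℤ,
    ∑ k ∈ Finset.range (N + 1), ((-1 : ℂ) ^ k * (N.choose k : ℂ)) • (a (m + N - k) * b (n + k)) =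
      superSign i j •
        ∑ k ∈ Finset.range (N + 1),
          ((-1 : ℂ) ^ k * (N.choose k : ℂ)) • (b (n + k) * a (m + N - k))

/-- `a(z)` is a homogeneous vertex operator of parity `i` on the `ℤ/2`-graded space `M` with
the operator `D`. -/
structure IsVertexOperator (grading : ZMod 2 → Submodule ℂ M) (D : Module.End ℂ M)
    (i : ZMod 2) (a : FormalSeries M) : Prop where
  homogeneous : ∀ (n : ℤ) (j : ZMod 2), ∀ w ∈ grading j, a n w ∈ grading (i + j)
  truncation : ∀ w : M, ∃ N : ℤ, ∀ n ≥ N, a n w = 0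
  self_local : MutuallyLocal i i a a
  /-- `[D, a(z)] = (d/dz) a(z)`. -/
  derivation : ∀ n : ℤ, D * a n - a n * D = -(n : ℂ) • a (n - 1)

/-- `Y`, the vacuum vector `vac` and the derivation `D` make the `ℤ/2`-graded space `M` a
vertex superalgebra; `Y u n v` is the product `uₙ v`, i.e. `Y(u, z) = ∑ₙ Y u n z^{-n-1}`. -/
structure IsVertexSuperalgebra (grading : ZMod 2 → Submodule ℂ M) (vac : M)
    (D : Module.End ℂ M) (Y : M →ₗ[ℂ] FormalSeries M) : Prop where
  isInternal : DirectSum.IsInternal grading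
  truncation : ∀ u v : M, ∃ N : ℤ, ∀ n ≥ N, Y u n v = 0
  /-- `[D, Y(u, z)] = Y(D u, z)`. -/
  derivation_commutator : ∀ (u : M) (n : ℤ), D * Y u n - Y u n * D = Y (D u) n
  /-- `Y(D u, z) = (d/dz) Y(u, z)`. -/
  derivation_deriv : ∀ (u : M) (n : ℤ), Y (D u) n = -(n : ℂ) • Y u (n - 1)
  /-- `Y(1, z) = id`. -/
  vacuum : ∀ n : ℤ, Y vac n = if n = -1 then 1 else 0
  /-- `Y(u, z) 1` is a power series in `z` ... -/
  creation_regular : ∀ (u : M) (n : ℤ), 0 ≤ n → Y u n vac = 0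
  /-- ... with constant term `u`. -/
  creation_limit : ∀ u : M, Y u (-1) vac = u
  /-- The Jacobi identity
  `z₀⁻¹ δ((z₁-z₂)/z₀) Y(u,z₁) Y(v,z₂) - ε z₀⁻¹ δ((z₂-z₁)/(-z₀)) Y(v,z₂) Y(u,z₁)
    = z₂⁻¹ δ((z₁-z₀)/z₂) Y(Y(u,z₀)v,z₂)`,
  applied to `w`: the coefficients of `z₀^{-k-1} z₁^{-m-1} z₂^{-n-1}` agree. Both sums have only
  finitely many nonzero terms, because of `truncation`. -/
  jacobi : ∀ (i j : ZMod 2), ∀ u ∈ grading i, ∀ v ∈ grading j, ∀ (w : M) (k m n : ℤ),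
    ∑ᶠ l : ℕ, ((-1 : ℂ) ^ l * ((Ring.choose k l : ℤ) : ℂ)) •
        (Y u (m + k - l) (Y v (n + l) w) -
          (superSign i j * (-1 : ℂ) ^ k) • Y v (n + k - l) (Y u (m + l) w)) =
      ∑ᶠ l : ℕ, ((Ring.choose m l : ℤ) : ℂ) • Y (Y u (k + l) v) (m + n - l) w
  parity : ∀ (i j : ZMod 2), ∀ u ∈ grading i, ∀ v ∈ grading j, ∀ n : ℤ,
    Y u n v ∈ grading (i + j)

/-- The subspace `S` is a vertex superalgebra contained in `M`: a `ℤ/2`-graded subspace that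
contains the vacuum and is closed under `D` and all the products. -/
structure IsVertexSubsuperalgebra (grading : ZMod 2 → Submodule ℂ M) (vac : M)
    (D : Module.End ℂ M) (Y : M →ₗ[ℂ] FormalSeries M) (S : Submodule ℂ M) : Prop where
  graded : S ≤ ⨆ i : ZMod 2, S ⊓ grading i
  vac_mem : vac ∈ S
  D_mem : ∀ u ∈ S, D u ∈ S
  mul_mem : ∀ u ∈ S, ∀ v ∈ S, ∀ n : ℤ, Y u n v ∈ S

/-- The smallest vertex superalgebra contained in `M` which contains the set `X`. -/
def generatedBy (grading : ZMod 2 → Submodule ℂ M) (vac : M)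
    (D : Module.End ℂ M) (Y : M →ₗ[ℂ] FormalSeries M) (X : Set M) : Submodule ℂ M :=
  sInf {S | IsVertexSubsuperalgebra grading vac D Y S ∧ X ⊆ S}

end VertexSuperalgebra

/-! ## The enveloping algebra of a Lie superalgebra -/

section Enveloping

variable {L : Type*} [AddCommGroup L] [Module ℂ L]
variable (grading : ZMod 2 → Submodule ℂ L) (br : L →ₗ[ℂ] L →ₗ[ℂ] L)

/-- The defining relations `x y = ε y x + [x, y]`, for homogeneous `x, y ∈ L`, of the universal
enveloping algebra of a Lie superalgebra `L` with bracket `br`. -/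
inductive EnvelopingRel : TensorAlgebra ℂ L → TensorAlgebra ℂ L → Prop
  | comm (i j : ZMod 2) (x y : L) (hx : x ∈ grading i) (hy : y ∈ grading j) :
      EnvelopingRel (TensorAlgebra.ι ℂ x * TensorAlgebra.ι ℂ y)
        (superSign i j • (TensorAlgebra.ι ℂ y * TensorAlgebra.ι ℂ x) +
          TensorAlgebra.ι ℂ (br x y))

/-- The universal enveloping algebra of a Lie superalgebra: the tensor algebra modulo the
two-sided ideal generated by the defining relations. -/
abbrev Enveloping : Type _ := RingQuot (EnvelopingRel grading br)

/-- The canonical map of a Lie superalgebra to its universal enveloping algebra. -/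
def Enveloping.ι : L →ₗ[ℂ] Enveloping grading br :=
  (RingQuot.mkAlgHom ℂ (EnvelopingRel grading br)).toLinearMap ∘ₗ TensorAlgebra.ι ℂ

/-- The component of parity `i` of the universal enveloping algebra: it is spanned by the products
`x₁ ⋯ xₖ` of homogeneous `xₛ ∈ L` with `|x₁| + ⋯ + |xₖ| = i`. -/
def Enveloping.parityPart (i : ZMod 2) : Submodule ℂ (Enveloping grading br) :=
  Submodule.span ℂ
    {a | ∃ l : List (ZMod 2 × L), (∀ p ∈ l, p.2 ∈ grading p.1) ∧
      (l.map Prod.fst).sum = i ∧ (l.map fun p => Enveloping.ι grading br p.2).prod = a}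

variable {grading br}

theorem Enveloping.ι_mul_ι {i j : ZMod 2} {x y : L} (hx : x ∈ grading i) (hy : y ∈ grading j) :
    Enveloping.ι grading br x * Enveloping.ι grading br y =
      superSign i j • (Enveloping.ι grading br y * Enveloping.ι grading br x) +
        Enveloping.ι grading br (br x y) := by
  have h := RingQuot.mkAlgHom_rel ℂ (EnvelopingRel.comm (br := br) i j x y hx hy)
  simpa [Enveloping.ι] using h

/-- Auxiliary algebra map `a ↦ (a, D a)` into the square zero extension of the enveloping algebra,
for an even derivation `d` of a Lie superalgebra. -/
def Enveloping.derivationAux (d : L →ₗ[ℂ] L)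
    (heven : ∀ i, ∀ x ∈ grading i, d x ∈ grading i)
    (hder : ∀ x y, d (br x y) = br (d x) y + br x (d y)) :
    Enveloping grading br →ₐ[ℂ]
      TrivSqZeroExt (Enveloping grading br) (Enveloping grading br) :=
  RingQuot.liftAlgHom ℂ
    ⟨TensorAlgebra.lift ℂ
      { toFun := fun x => TrivSqZeroExt.inl (Enveloping.ι grading br x) +
          TrivSqZeroExt.inr (Enveloping.ι grading br (d x))
        map_add' := fun x y => by ext <;> simp
        map_smul' := fun c x => by ext <;> simp }, by
      rintro _ _ ⟨i, j, x, y, hx, hy⟩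
      ext
      · simp [Enveloping.ι_mul_ι hx hy]
      · simp [Enveloping.ι_mul_ι hx (heven j y hy), Enveloping.ι_mul_ι (heven i x hx) hy, hder]
        module⟩

/-- The extension of an even derivation `d` of a Lie superalgebra to a derivation of the
universal enveloping algebra. -/
def Enveloping.derivation (d : L →ₗ[ℂ] L)
    (heven : ∀ i, ∀ x ∈ grading i, d x ∈ grading i)
    (hder : ∀ x y, d (br x y) = br (d x) y + br x (d y)) :
    Module.End ℂ (Enveloping grading br) :=
  { toFun := fun a => (Enveloping.derivationAux d heven hder a).snd
    map_add' := fun a b => by simp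
    map_smul' := fun c a => by simp }

theorem Enveloping.derivationAux_ι (d : L →ₗ[ℂ] L)
    (heven : ∀ i, ∀ x ∈ grading i, d x ∈ grading i)
    (hder : ∀ x y, d (br x y) = br (d x) y + br x (d y)) (x : L) :
    Enveloping.derivationAux d heven hder (Enveloping.ι grading br x) =
      TrivSqZeroExt.inl (Enveloping.ι grading br x) +
        TrivSqZeroExt.inr (Enveloping.ι grading br (d x)) := by
  simp [Enveloping.derivationAux, Enveloping.ι]

theorem Enveloping.fst_derivationAux (d : L →ₗ[ℂ] L)
    (heven : ∀ i, ∀ x ∈ grading i, d x ∈ grading i)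
    (hder : ∀ x y, d (br x y) = br (d x) y + br x (d y)) (a : Enveloping grading br) :
    (Enveloping.derivationAux d heven hder a).fst = a := by
  have h : (TrivSqZeroExt.fstHom ℂ (Enveloping grading br) (Enveloping grading br)).comp
      (Enveloping.derivationAux d heven hder) = AlgHom.id ℂ _ := by
    apply RingQuot.ringQuot_ext'
    ext x
    have := Enveloping.derivationAux_ι d heven hder x
    simp only [Enveloping.ι, LinearMap.comp_apply, AlgHom.toLinearMap_apply] at this
    simp [this]
  exact DFunLike.congr_fun h a

theorem Enveloping.derivation_ι (d : L →ₗ[ℂ] L)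
    (heven : ∀ i, ∀ x ∈ grading i, d x ∈ grading i)
    (hder : ∀ x y, d (br x y) = br (d x) y + br x (d y)) (x : L) :
    Enveloping.derivation d heven hder (Enveloping.ι grading br x) =
      Enveloping.ι grading br (d x) := by
  simp [Enveloping.derivation, Enveloping.derivationAux_ι]

theorem Enveloping.derivation_mul (d : L →ₗ[ℂ] L)
    (heven : ∀ i, ∀ x ∈ grading i, d x ∈ grading i)
    (hder : ∀ x y, d (br x y) = br (d x) y + br x (d y)) (a b : Enveloping grading br) :
    Enveloping.derivation d heven hder (a * b) =
      Enveloping.derivation d heven hder a * b + a * Enveloping.derivation d heven hder b := by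
  simp [Enveloping.derivation, Enveloping.fst_derivationAux, add_comm]

end Enveloping

/-! ## Vertex Lie superalgebras -/

/-- A vertex Lie superalgebra structure on the complex vector space `U`: a `ℤ/2`-grading, a
derivation `D` and products `uₙ v = Y u n v` for `n ∈ ℕ`. -/
structure VertexLieSuperalgebra (U : Type*) [AddCommGroup U] [Module ℂ U] where
  grading : ZMod 2 → Submodule ℂ U
  isInternal : DirectSum.IsInternal grading
  D : Module.End ℂ U
  D_even : ∀ i, ∀ u ∈ grading i, D u ∈ grading i
  /-- `Y(u, z) = ∑_{n ≥ 0} (Y u n) z^{-n-1}`. -/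
  Y : U →ₗ[ℂ] (ℕ → Module.End ℂ U)
  truncation : ∀ u v : U, ∃ N : ℕ, ∀ n ≥ N, Y u n v = 0
  /-- `[D, Y(u, z)] = Y(D u, z)`. -/
  derivation_commutator : ∀ (u : U) (n : ℕ), D * Y u n - Y u n * D = Y (D u) n
  /-- `Y(D u, z) = (d/dz) Y(u, z)`, coefficient of `z⁻¹`. -/
  derivation_deriv_zero : ∀ u : U, Y (D u) 0 = 0
  /-- `Y(D u, z) = (d/dz) Y(u, z)`, coefficient of `z^{-n-2}`. -/
  derivation_deriv_succ : ∀ (u : U) (n : ℕ), Y (D u) (n + 1) = -((n : ℂ) + 1) • Y u n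
  /-- The half skew symmetry `Y(u, z) v ≃ ε e^{zD} Y(v, -z) u` (equality of principal parts): the
  coefficients of `z^{-n-1}`, `n ≥ 0`, agree. The sum has only finitely many nonzero terms. -/
  half_skew : ∀ (i j : ZMod 2), ∀ u ∈ grading i, ∀ v ∈ grading j, ∀ n : ℕ,
    Y u n v = -superSign i j •
      ∑ᶠ k : ℕ, ((-1 : ℂ) ^ (n + k) / (k.factorial : ℂ)) • (D ^ k) (Y v (n + k) u)
  /-- The half Jacobi identity (equality of the principal parts of the two sides of the Jacobi
  identity): the coefficients of `z₀^{-k-1} z₁^{-m-1} z₂^{-n-1}`, `k, m, n ≥ 0`, agree. In the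
  sums `l ≤ k` and `l ≤ m` respectively, so the subtractions are genuine. -/
  half_jacobi : ∀ (i j : ZMod 2), ∀ u ∈ grading i, ∀ v ∈ grading j, ∀ (w : U) (k m n : ℕ),
    ∑ l ∈ Finset.range (k + 1), ((-1 : ℂ) ^ l * (k.choose l : ℂ)) •
        (Y u (m + k - l) (Y v (n + l) w) -
          (superSign i j * (-1 : ℂ) ^ k) • Y v (n + k - l) (Y u (m + l) w)) =
      ∑ l ∈ Finset.range (m + 1), (m.choose l : ℂ) • Y (Y u (k + l) v) (m + n - l) w
  parity : ∀ (i j : ZMod 2), ∀ u ∈ grading i, ∀ v ∈ grading j, ∀ n : ℕ,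
    Y u n v ∈ grading (i + j)

namespace VertexLieSuperalgebra

variable {U : Type*} [AddCommGroup U] [Module ℂ U] (A : VertexLieSuperalgebra U)

/-! ### The Lie superalgebra `ℒ(U)` -/

/-- The affinization `U ⊗ ℂ[q, q⁻¹]`; the vector `uₙ = u ⊗ qⁿ` is `Finsupp.single n u`. -/
abbrev Affinization (_ : VertexLieSuperalgebra U) : Type _ := ℤ →₀ U

/-- The span of the vectors `(D u)ₙ + n u_{n-1}`. -/
def relations : Submodule ℂ A.Affinization :=
  Submodule.span ℂ {x | ∃ (u : U) (n : ℤ),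
    x = Finsupp.single n (A.D u) + (n : ℂ) • Finsupp.single (n - 1) u}

/-- The space `ℒ(U)`. -/
abbrev Loc : Type _ := A.Affinization ⧸ A.relations

/-- The element `uₙ` of `ℒ(U)`, as a linear function of `u`. -/
def mode (n : ℤ) : U →ₗ[ℂ] A.Loc := A.relations.mkQ ∘ₗ Finsupp.lsingle n

/-- The component of parity `i` of `ℒ(U)`. -/
def locGrading (i : ZMod 2) : Submodule ℂ A.Loc :=
  Submodule.span ℂ {x | ∃ u ∈ A.grading i, ∃ n : ℤ, x = A.mode n u}

theorem mode_D (n : ℤ) (u : U) : A.mode n (A.D u) = -(n : ℂ) • A.mode (n - 1) u := by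
  rw [neg_smul, eq_neg_iff_add_eq_zero]
  exact (Submodule.Quotient.mk_eq_zero A.relations).2 (Submodule.subset_span ⟨u, n, rfl⟩)

theorem loc_induction {P : A.Loc → Prop} (h0 : P 0) (hadd : ∀ x y, P x → P y → P (x + y))
    (hmode : ∀ n u, P (A.mode n u)) (x : A.Loc) : P x := by
  obtain ⟨x, rfl⟩ := A.relations.mkQ_surjective x
  induction x using Finsupp.induction_linear with
  | zero => simpa using h0
  | add f g hf hg => simpa using hadd _ _ hf hg
  | single n u => exact hmode n u

/-- The right-hand side `∑_{i ≥ 0} (n choose i) (uᵢ v)_{n+p-i}` of the commutator formula; the sum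
has only finitely many nonzero terms. -/
def modeBracket (u v : U) (n p : ℤ) : A.Loc :=
  ∑ᶠ i : ℕ, ((Ring.choose n i : ℤ) : ℂ) • A.mode (n + p - i) (A.Y u i v)

theorem modeBracket_eq {u v : U} {N : ℕ} (hN : ∀ i ≥ N, A.Y u i v = 0) (n p : ℤ) :
    A.modeBracket u v n p = ∑ i ∈ Finset.range N,
      ((Ring.choose n i : ℤ) : ℂ) • A.mode (n + p - i) (A.Y u i v) := by
  apply finsum_eq_sum_of_support_subset
  intro i hi
  by_contra h
  apply hi
  simp only [Finset.coe_range, Set.mem_Iio, not_lt] at h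
  simp [hN i h]

theorem modeBracket_add_left (u u' v : U) (n p : ℤ) :
    A.modeBracket (u + u') v n p = A.modeBracket u v n p + A.modeBracket u' v n p := by
  obtain ⟨N, hN⟩ := A.truncation u v
  obtain ⟨N', hN'⟩ := A.truncation u' v
  have h1 : ∀ i ≥ max N N', A.Y u i v = 0 := fun i hi => hN i (le_trans (le_max_left _ _) hi)
  have h2 : ∀ i ≥ max N N', A.Y u' i v = 0 := fun i hi => hN' i (le_trans (le_max_right _ _) hi)
  rw [A.modeBracket_eq h1, A.modeBracket_eq h2,
    A.modeBracket_eq (N := max N N') (fun i hi => by simp [h1 i hi, h2 i hi]),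
    ← Finset.sum_add_distrib]
  simp

theorem modeBracket_add_right (u v v' : U) (n p : ℤ) :
    A.modeBracket u (v + v') n p = A.modeBracket u v n p + A.modeBracket u v' n p := by
  obtain ⟨N, hN⟩ := A.truncation u v
  obtain ⟨N', hN'⟩ := A.truncation u v'
  have h1 : ∀ i ≥ max N N', A.Y u i v = 0 := fun i hi => hN i (le_trans (le_max_left _ _) hi)
  have h2 : ∀ i ≥ max N N', A.Y u i v' = 0 := fun i hi => hN' i (le_trans (le_max_right _ _) hi)
  rw [A.modeBracket_eq h1, A.modeBracket_eq h2,
    A.modeBracket_eq (N := max N N') (fun i hi => by simp [h1 i hi, h2 i hi]),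
    ← Finset.sum_add_distrib]
  simp

theorem modeBracket_smul_left (c : ℂ) (u v : U) (n p : ℤ) :
    A.modeBracket (c • u) v n p = c • A.modeBracket u v n p := by
  obtain ⟨N, hN⟩ := A.truncation u v
  rw [A.modeBracket_eq hN, A.modeBracket_eq (N := N) (fun i hi => by simp [hN i hi]),
    Finset.smul_sum]
  exact Finset.sum_congr rfl fun i _ => by simp [smul_comm c]

theorem modeBracket_smul_right (c : ℂ) (u v : U) (n p : ℤ) :
    A.modeBracket u (c • v) n p = c • A.modeBracket u v n p := by
  obtain ⟨N, hN⟩ := A.truncation u v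
  rw [A.modeBracket_eq hN, A.modeBracket_eq (N := N) (fun i hi => by simp [hN i hi]),
    Finset.smul_sum]
  exact Finset.sum_congr rfl fun i _ => by simp [smul_comm c]

theorem succ_mul_choose (n : ℤ) (i : ℕ) :
    ((i : ℂ) + 1) * ((Ring.choose n (i + 1) : ℤ) : ℂ) =
      ((n : ℂ) - i) * ((Ring.choose n i : ℤ) : ℂ) := by
  have h := Ring.choose_smul_choose n (Nat.le_succ i)
  rw [Nat.succ_eq_add_one, Nat.choose_succ_self_right, Nat.add_sub_cancel_left,
    Ring.choose_one_right] at h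
  have h' := congrArg (fun x : ℤ => (x : ℂ)) h
  push_cast [nsmul_eq_mul] at h'
  linear_combination h'

theorem succ_mul_choose' (n : ℤ) (i : ℕ) :
    ((i : ℂ) + 1) * ((Ring.choose n (i + 1) : ℤ) : ℂ) =
      (n : ℂ) * ((Ring.choose (n - 1) i : ℤ) : ℂ) := by
  have h := Ring.choose_smul_choose n (Nat.succ_le_succ (Nat.zero_le i))
  simp only [Nat.succ_eq_add_one, zero_add, Nat.choose_one_right, Nat.add_sub_cancel,
    Ring.choose_one_right, Nat.cast_one] at h
  have h' := congrArg (fun x : ℤ => (x : ℂ)) h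
  push_cast [nsmul_eq_mul] at h'
  linear_combination h'

theorem modeBracket_relation_left (u v : U) (n p : ℤ) :
    A.modeBracket (A.D u) v n p + (n : ℂ) • A.modeBracket u v (n - 1) p = 0 := by
  obtain ⟨N, hN⟩ := A.truncation u v
  rw [A.modeBracket_eq hN, A.modeBracket_eq (N := N + 1), Finset.sum_range_succ',
    Finset.smul_sum, A.derivation_deriv_zero]
  · simp only [LinearMap.zero_apply, map_zero, smul_zero, add_zero]
    rw [← Finset.sum_add_distrib]
    refine Finset.sum_eq_zero fun i _ => ?_
    have e : n + p - ((i + 1 : ℕ) : ℤ) = n - 1 + p - i := by push_cast; ring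
    rw [A.derivation_deriv_succ, e, LinearMap.smul_apply, map_smul, smul_smul, smul_smul,
      ← add_smul]
    have h := succ_mul_choose' n i
    rw [show ((Ring.choose n (i + 1) : ℤ) : ℂ) * -((i : ℂ) + 1) +
      (n : ℂ) * ((Ring.choose (n - 1) i : ℤ) : ℂ) = 0 by linear_combination -h, zero_smul]
  · intro i hi
    obtain ⟨i, rfl⟩ : ∃ j, i = j + 1 := ⟨i - 1, by omega⟩
    rw [A.derivation_deriv_succ, LinearMap.smul_apply, hN i (by omega), smul_zero]

theorem D_Y (u v : U) (i : ℕ) : A.D (A.Y u i v) = A.Y (A.D u) i v + A.Y u i (A.D v) := by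
  have h := LinearMap.congr_fun (A.derivation_commutator u i) v
  simp only [LinearMap.sub_apply, Module.End.mul_apply] at h
  rw [← h, sub_add_cancel]

theorem Y_D_eq_zero {u v : U} {N : ℕ} (hN : ∀ i ≥ N, A.Y u i v = 0) :
    ∀ i ≥ N + 1, A.Y u i (A.D v) = 0 ∧ A.Y (A.D u) i v = 0 := by
  intro i hi
  obtain ⟨i, rfl⟩ : ∃ j, i = j + 1 := ⟨i - 1, by omega⟩
  have h : A.Y (A.D u) (i + 1) v = 0 := by
    rw [A.derivation_deriv_succ, LinearMap.smul_apply, hN i (by omega), smul_zero]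
  have h' := A.D_Y u v (i + 1)
  rw [h, hN (i + 1) (by omega), map_zero, zero_add] at h'
  exact ⟨h'.symm, h⟩

theorem modeBracket_relation_right (u v : U) (n p : ℤ) :
    A.modeBracket u (A.D v) n p + (p : ℂ) • A.modeBracket u v n (p - 1) = 0 := by
  obtain ⟨N, hN⟩ := A.truncation u v
  have hN' : ∀ i ≥ N + 1, A.Y u i v = 0 := fun i hi => hN i (by omega)
  have e1 : A.modeBracket u (A.D v) n p + A.modeBracket (A.D u) v n p =
      ∑ i ∈ Finset.range (N + 1), ((Ring.choose n i : ℤ) : ℂ) •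
        A.mode (n + p - i) (A.D (A.Y u i v)) := by
    rw [A.modeBracket_eq (fun i hi => (A.Y_D_eq_zero hN i hi).1),
      A.modeBracket_eq (fun i hi => (A.Y_D_eq_zero hN i hi).2), ← Finset.sum_add_distrib]
    refine Finset.sum_congr rfl fun i _ => ?_
    rw [A.D_Y, map_add, smul_add, add_comm]
  have e2 := A.modeBracket_relation_left u v n p
  have e3 : (n : ℂ) • A.modeBracket u v (n - 1) p = ∑ i ∈ Finset.range (N + 1),
      (((n : ℂ) - i) * ((Ring.choose n i : ℤ) : ℂ)) • A.mode (n + p - i - 1) (A.Y u i v) := by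
    rw [A.modeBracket_eq hN', Finset.smul_sum]
    refine Finset.sum_congr rfl fun i _ => ?_
    rw [smul_smul, ← succ_mul_choose', succ_mul_choose,
      show n - 1 + p - (i : ℤ) = n + p - i - 1 by ring]
  have e4 : (p : ℂ) • A.modeBracket u v n (p - 1) = ∑ i ∈ Finset.range (N + 1),
      ((p : ℂ) * ((Ring.choose n i : ℤ) : ℂ)) • A.mode (n + p - i - 1) (A.Y u i v) := by
    rw [A.modeBracket_eq hN', Finset.smul_sum]
    refine Finset.sum_congr rfl fun i _ => ?_
    rw [smul_smul, show n + (p - 1) - (i : ℤ) = n + p - i - 1 by ring]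
  have e5 : ∑ i ∈ Finset.range (N + 1), ((Ring.choose n i : ℤ) : ℂ) •
      A.mode (n + p - i) (A.D (A.Y u i v)) +
      ((n : ℂ) • A.modeBracket u v (n - 1) p + (p : ℂ) • A.modeBracket u v n (p - 1)) = 0 := by
    rw [e3, e4, ← Finset.sum_add_distrib, ← Finset.sum_add_distrib]
    refine Finset.sum_eq_zero fun i _ => ?_
    rw [A.mode_D]
    push_cast
    module
  rw [← e1] at e5
  have e6 := congrArg₂ (· - ·) e5 e2
  simp only [sub_zero] at e6
  rw [← e6]
  abel

/-- The linear map on `ℒ(U)` with prescribed values `f n u` on the vectors `uₙ`. -/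
def locLift {P : Type*} [AddCommGroup P] [Module ℂ P] (f : ℤ → U →ₗ[ℂ] P)
    (hf : ∀ (u : U) (n : ℤ), f n (A.D u) + (n : ℂ) • f (n - 1) u = 0) : A.Loc →ₗ[ℂ] P :=
  A.relations.liftQ (Finsupp.lsum ℂ f) (by
    refine Submodule.span_le.2 ?_
    rintro _ ⟨u, n, rfl⟩
    rw [SetLike.mem_coe, LinearMap.mem_ker, map_add, map_smul, Finsupp.lsum_single,
      Finsupp.lsum_single]
    exact hf u n)

theorem locLift_mode {P : Type*} [AddCommGroup P] [Module ℂ P] (f : ℤ → U →ₗ[ℂ] P)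
    (hf : ∀ (u : U) (n : ℤ), f n (A.D u) + (n : ℂ) • f (n - 1) u = 0) (n : ℤ) (u : U) :
    A.locLift f hf (A.mode n u) = f n u := by
  refine (Submodule.liftQ_apply _ _ _).trans ?_
  exact Finsupp.lsum_single ℂ f n u

theorem loc_hom_ext {P : Type*} [AddCommGroup P] [Module ℂ P] {f g : A.Loc →ₗ[ℂ] P}
    (h : ∀ n u, f (A.mode n u) = g (A.mode n u)) : f = g := by
  refine LinearMap.ext fun x => ?_
  exact A.loc_induction (P := fun x => f x = g x) (by simp)
    (fun x y hx hy => by rw [map_add, map_add, hx, hy]) h x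

/-- The right-hand side of the commutator formula as a linear function of `v`. -/
def modeBracketRight (u : U) (n p : ℤ) : U →ₗ[ℂ] A.Loc where
  toFun v := A.modeBracket u v n p
  map_add' v v' := A.modeBracket_add_right u v v' n p
  map_smul' c v := A.modeBracket_smul_right c u v n p

theorem modeBracketRight_relation (u : U) (n : ℤ) (v : U) (p : ℤ) :
    A.modeBracketRight u n p (A.D v) + (p : ℂ) • A.modeBracketRight u n (p - 1) v = 0 :=
  A.modeBracket_relation_right u v n p

/-- The bracket of `u ⊗ qⁿ` with the elements of `ℒ(U)`, as a linear function of `u`. -/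
def bracketAux (n : ℤ) : U →ₗ[ℂ] A.Loc →ₗ[ℂ] A.Loc where
  toFun u := A.locLift (A.modeBracketRight u n) (A.modeBracketRight_relation u n)
  map_add' u u' := A.loc_hom_ext fun p v => by
    rw [LinearMap.add_apply, locLift_mode, locLift_mode, locLift_mode]
    exact A.modeBracket_add_left u u' v n p
  map_smul' c u := A.loc_hom_ext fun p v => by
    rw [LinearMap.smul_apply, locLift_mode, locLift_mode]
    exact A.modeBracket_smul_left c u v n p

theorem bracketAux_mode (n p : ℤ) (u v : U) :
    A.bracketAux n u (A.mode p v) = A.modeBracket u v n p :=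
  A.locLift_mode (A.modeBracketRight u n) (A.modeBracketRight_relation u n) p v

/-- The bracket of `ℒ(U)`: `[uₙ, vₚ] = ∑_{i ≥ 0} (n choose i) (uᵢ v)_{n+p-i}`. -/
def bracket : A.Loc →ₗ[ℂ] A.Loc →ₗ[ℂ] A.Loc :=
  A.locLift A.bracketAux fun u n => A.loc_hom_ext fun p v => by
    rw [LinearMap.add_apply, LinearMap.smul_apply, bracketAux_mode, bracketAux_mode,
      LinearMap.zero_apply]
    exact A.modeBracket_relation_left u v n p

theorem bracket_mode (n p : ℤ) (u v : U) :
    A.bracket (A.mode n u) (A.mode p v) =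
      ∑ᶠ i : ℕ, ((Ring.choose n i : ℤ) : ℂ) • A.mode (n + p - i) (A.Y u i v) := by
  rw [bracket, locLift_mode, bracketAux_mode, modeBracket]

/-- The derivation `D` of `ℒ(U)`: `D(uₙ) = (D u)ₙ`. -/
def locD : Module.End ℂ A.Loc :=
  A.locLift (fun n => A.mode n ∘ₗ A.D) fun u n => by
    simp [A.mode_D n (A.D u)]

theorem locD_mode (n : ℤ) (u : U) : A.locD (A.mode n u) = A.mode n (A.D u) :=
  A.locLift_mode _ _ n u

theorem locD_even (i : ZMod 2) (x : A.Loc) (hx : x ∈ A.locGrading i) :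
    A.locD x ∈ A.locGrading i := by
  have h : A.locGrading i ≤ (A.locGrading i).comap A.locD := by
    refine Submodule.span_le.2 ?_
    rintro _ ⟨u, hu, n, rfl⟩
    exact Submodule.subset_span ⟨A.D u, A.D_even i u hu, n, A.locD_mode n u⟩
  exact h hx

theorem locD_bracket (x y : A.Loc) :
    A.locD (A.bracket x y) = A.bracket (A.locD x) y + A.bracket x (A.locD y) := by
  refine A.loc_induction (P := fun x => A.locD (A.bracket x y) =
    A.bracket (A.locD x) y + A.bracket x (A.locD y)) (by simp)
    (fun x x' hx hx' => ?_) (fun n u => ?_) x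
  · simp only [map_add, LinearMap.add_apply, hx, hx']; abel
  refine A.loc_induction (P := fun y => A.locD (A.bracket (A.mode n u) y) =
    A.bracket (A.locD (A.mode n u)) y + A.bracket (A.mode n u) (A.locD y)) (by simp)
    (fun y y' hy hy' => ?_) (fun p v => ?_) y
  · simp only [map_add, hy, hy']; abel
  obtain ⟨N, hN⟩ := A.truncation u v
  have hN' : ∀ i ≥ N + 1, A.Y u i v = 0 := fun i hi => hN i (by omega)
  rw [A.locD_mode, A.locD_mode, A.bracket_mode, A.bracket_mode, A.bracket_mode]
  change A.locD (A.modeBracket u v n p) =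
    A.modeBracket (A.D u) v n p + A.modeBracket u (A.D v) n p
  rw [A.modeBracket_eq hN', A.modeBracket_eq (fun i hi => (A.Y_D_eq_zero hN i hi).1),
    A.modeBracket_eq (fun i hi => (A.Y_D_eq_zero hN i hi).2), ← Finset.sum_add_distrib, map_sum]
  refine Finset.sum_congr rfl fun i _ => ?_
  rw [map_smul, A.locD_mode, A.D_Y, map_add, smul_add]

/-! ### The generalized Verma module `𝒱(U)` -/

/-- The universal enveloping algebra of the Lie superalgebra `ℒ(U)`. -/
abbrev Env : Type _ := Enveloping A.locGrading A.bracket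

/-- The derivation of the universal enveloping algebra of `ℒ(U)` extending the derivation `D` of
`ℒ(U)`. -/
def envD : Module.End ℂ A.Env := Enveloping.derivation A.locD A.locD_even A.locD_bracket

/-- The left ideal of the universal enveloping algebra generated by `ℒ₊(U)`, which is the span of
all `uₙ` with `u ∈ U` and `n ≥ 0`. -/
def leftIdeal : Submodule A.Env A.Env :=
  Submodule.span A.Env {a | ∃ (u : U) (n : ℤ), 0 ≤ n ∧
    a = Enveloping.ι A.locGrading A.bracket (A.mode n u)}

/-- The generalized Verma module `𝒱(U)`, the module over the enveloping algebra of `ℒ(U)` induced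
from the trivial `ℒ₊(U)`-module `ℂ`. -/
abbrev Verma : Type _ := A.Env ⧸ A.leftIdeal

/-- The quotient map of the enveloping algebra of `ℒ(U)` onto `𝒱(U)`. -/
def vermaMk : A.Env →ₗ[ℂ] A.Verma := A.leftIdeal.mkQ.restrictScalars ℂ

/-- The vector `1 ∈ 𝒱(U)`. -/
def vermaVac : A.Verma := A.vermaMk 1

/-- The component of parity `i` of `𝒱(U)`. -/
def vermaGrading (i : ZMod 2) : Submodule ℂ A.Verma :=
  (Enveloping.parityPart A.locGrading A.bracket i).map A.vermaMk

theorem envD_mem (a : A.Env) (ha : a ∈ A.leftIdeal) : A.envD a ∈ A.leftIdeal := by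
  refine Submodule.span_induction ?_ (by simp) (fun x y _ _ hx hy => ?_)
    (fun b x hx' hx => ?_) ha
  · rintro _ ⟨u, n, hn, rfl⟩
    refine Submodule.subset_span ⟨A.D u, n, hn, ?_⟩
    rw [envD, Enveloping.derivation_ι, locD_mode]
  · rw [map_add]; exact add_mem hx hy
  · rw [smul_eq_mul, envD, Enveloping.derivation_mul]
    exact add_mem (A.leftIdeal.smul_mem _ hx') (A.leftIdeal.smul_mem _ hx)

/-- The operator `D` on `𝒱(U)` induced by the derivation `D` of the enveloping algebra. -/
def vermaD : Module.End ℂ A.Verma :=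
  (A.leftIdeal.restrictScalars ℂ).mapQ (A.leftIdeal.restrictScalars ℂ) A.envD A.envD_mem

/-- The series `Y_{𝒱(U)}(u, z) = ∑ₙ uₙ z^{-n-1}`, where `uₙ ∈ ℒ(U)` acts on `𝒱(U)` by left
multiplication. -/
def vermaField (u : U) : FormalSeries A.Verma :=
  fun n => Algebra.lsmul ℂ ℂ A.Verma (Enveloping.ι A.locGrading A.bracket (A.mode n u))

/-- The map `κ : U → 𝒱(U)`, `κ(u) = u₋₁ 1`. -/
def kappa : U →ₗ[ℂ] A.Verma :=
  A.vermaMk ∘ₗ Enveloping.ι A.locGrading A.bracket ∘ₗ A.mode (-1)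

end VertexLieSuperalgebra

end VertexLie

end

/-! The bracket of `ℒ(U)` says that the commutator of two fields `u(z₁)`, `v(z₂)` on `𝒱(U)` is a
finite combination of derivatives of the delta function, with coefficients the fields of `u_l v`. A
power of `z₁ - z₂` kills it, so the fields are mutually local (`vermaField_mem_localTo`). They
truncate because they do so on the vacuum and commutators preserve this (`isTruncated_vermaField`).
The rest is reconstruction of a vertex superalgebra from local fields whose modes generate the space
from the vacuum.

Let `F` be the space of all series of a given parity that are compatible with `D`, regular on the
vacuum, and local to the generating fields. Residues of the left side of the Jacobi identity define
products `a₍ₖ₎b`, and Dong's lemma (`nprod_mem_localTo`) keeps products of mutually local members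
inside `F`. The map `a ↦ a₋₁ 1` is injective on `F` by Goddard's theorem
(`eq_zero_of_state_eq_zero`), and onto the part of that parity because the state of `a₍ₖ₎b` is `aₖ`
applied to the state of `b` (`IsCreative.nprod_vac`, `exists_local_field`). Its inverse is `Y`.
Injectivity then gives the remaining facts by comparison of states: any two members of `F` are local
to each other, `Y(uₖ v) = Y(u)₍ₖ₎Y(v)`, and `Y(Du) = Y(u)'`. Local series satisfy the Jacobi
identity for their products (`jacobiLeft_eq_finsum_nprod`), hence so does `Y`. Any competing
structure also has its fields in `F` with the same states, so it is equal to `Y`.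

Formal calculus is done on coefficient families. The expansions of `(z₁ - z₂)^k f` for all integers
`k` are linked by multiplication by `z₁ - z₂`, whose kernel consists of families constant on
antidiagonals. Truncation excludes nonzero constants, so statements for every `k` can be reduced to
`k = 0` (`family_eq_zero`). -/

noncomputable section

namespace VertexLie

/-! ## Expansions of powers of `z₁ - z₂` -/

section Expansion

section

variable {E : Type*} [AddCommGroup E]

/-- A series killed by `z₁ - z₂` is a multiple of the delta function: its coefficients depend on `m
+ n` only, so a single zero on an antidiagonal propagates along it. -/
theorem eq_zero_of_antidiagonal {g : ℤ → ℤ → E} (hg : ∀ m n, g (m + 1) n = g m (n + 1))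
    {m n : ℤ} (r : ℤ) (hr : g (m + r) (n - r) = 0) : g m n = 0 := by
  have key : ∀ s : ℤ, g (m + s) (n - s) = g m n := by
    intro s
    induction s using Int.induction_on with
    | zero => simp
    | succ s ih =>
      rw [← ih, ← add_assoc, hg]
      congr 1
      ring
    | pred s ih =>
      rw [← ih, show m + -(s : ℤ) = m + (-(s : ℤ) - 1) + 1 by ring, hg]
      congr 1
      ring
  rw [← key r, hr]

/-- A family `H k` with `H (k + 1) = (z₁ - z₂) H k` and `H 0 = 0`, all whose members vanish
somewhere on each antidiagonal, is zero. -/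
theorem family_eq_zero {H : ℤ → ℤ → ℤ → E}
    (hsucc : ∀ k m n, H (k + 1) m n = H k (m + 1) n - H k m (n + 1))
    (h0 : ∀ m n, H 0 m n = 0) (htr : ∀ k m n, ∃ r : ℤ, H k (m + r) (n - r) = 0) (k : ℤ) :
    ∀ m n, H k m n = 0 := by
  induction k using Int.induction_on with
  | zero => exact h0
  | succ k ih => intro m n; rw [hsucc, ih, ih, sub_zero]
  | pred k ih =>
    intro m n
    -- Going down in `k`, the recursion only shows that the member is killed by `z₁ - z₂`; the
    -- vanishing point on each antidiagonal does the rest.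
    obtain ⟨r, hr⟩ := htr (-(k : ℤ) - 1) m n
    refine eq_zero_of_antidiagonal (g := H (-(k : ℤ) - 1)) (fun m n => ?_) r hr
    have := hsucc (-(k : ℤ) - 1) m n
    rw [sub_add_cancel, ih] at this
    exact sub_eq_zero.1 this.symm

end

variable {E : Type*} [AddCommGroup E] [Module ℂ E]

/-- Pascal's rule for an arbitrary integer upper index. The bound on `g` is essential: a `finsum`
with infinite support takes the default value `0`. -/
theorem choose_succ_finsum (x : ℤ) (g : ℕ → E) {N : ℕ} (hg : ∀ l ≥ N, g l = 0) :
    ∑ᶠ l : ℕ, ((Ring.choose (x + 1) l : ℤ) : ℂ) • g l =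
      ∑ᶠ l : ℕ, ((Ring.choose x l : ℤ) : ℂ) • g l +
        ∑ᶠ l : ℕ, ((Ring.choose x l : ℤ) : ℂ) • g (l + 1) := by
  have key : ∀ (c : ℕ → ℂ) (h : ℕ → E), (∀ l ≥ N + 1, h l = 0) →
      ∑ᶠ l : ℕ, c l • h l = ∑ l ∈ Finset.range (N + 1), c l • h l := by
    intro c h hh
    apply finsum_eq_sum_of_support_subset
    intro i hi
    by_contra hc
    simp only [Finset.coe_range, Set.mem_Iio, not_lt] at hc
    exact hi (by simp [hh i hc])
  rw [key _ g fun l hl => hg l (by omega), key _ g fun l hl => hg l (by omega),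
    key _ (fun l => g (l + 1)) fun l hl => hg _ (by omega), Finset.sum_range_succ',
    Finset.sum_range_succ' (fun l => ((Ring.choose x l : ℤ) : ℂ) • g l),
    Finset.sum_range_succ (fun l => ((Ring.choose x l : ℤ) : ℂ) • g (l + 1)),
    hg (N + 1) (by omega), smul_zero, add_zero, add_right_comm, ← Finset.sum_add_distrib]
  simp only [Ring.choose_zero_right, Ring.choose_succ_succ, Int.cast_add, add_smul]
  simp only [add_comm]

/-- The coefficients of the expansion of `(z₁ - z₂)^k f(z₁, z₂)` in nonnegative powers
of `z₂`. -/
def expand (k : ℤ) (f : ℤ → ℤ → E) : ℤ → ℤ → E := fun m n =>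
  ∑ᶠ l : ℕ, ((-1 : ℂ) ^ l * ((Ring.choose k l : ℤ) : ℂ)) • f (m + k - l) (n + l)

theorem expand_eq_zero {f : ℤ → ℤ → E} {N n : ℤ} (hf : ∀ n ≥ N, ∀ m, f m n = 0) (hn : N ≤ n)
    (k m : ℤ) : expand k f m n = 0 :=
  finsum_eq_zero_of_forall_eq_zero fun l => by rw [hf _ (by omega), smul_zero]

theorem expand_zero (f : ℤ → ℤ → E) (m n : ℤ) : expand 0 f m n = f m n := by
  rw [expand, finsum_eq_single _ 0]
  · simp
  · intro l hl
    rw [Ring.choose_zero_pos ℤ (Nat.pos_of_ne_zero hl)]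
    simp

theorem expand_finite {f : ℤ → ℤ → E} {N : ℤ} (hf : ∀ n ≥ N, ∀ m, f m n = 0) (k m n : ℤ) :
    (Function.support fun l : ℕ =>
      ((-1 : ℂ) ^ l * ((Ring.choose k l : ℤ) : ℂ)) • f (m + k - l) (n + l)).Finite := by
  refine (Set.finite_lt_nat (N - n).toNat).subset fun l hl => ?_
  by_contra hc
  simp only [Set.mem_ofPred_eq, not_lt] at hc
  exact hl (by simp only [hf (n + l) (by omega), smul_zero])

/-- Valid for negative `k` too, by Pascal's rule; this is the recursion that `family_eq_zero` needs.
-/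
theorem expand_succ {f : ℤ → ℤ → E} {N : ℤ} (hf : ∀ n ≥ N, ∀ m, f m n = 0) (k m n : ℤ) :
    expand (k + 1) f m n = expand k f (m + 1) n - expand k f m (n + 1) := by
  have h := choose_succ_finsum k (fun l : ℕ => (-1 : ℂ) ^ l • f (m + (k + 1) - l) (n + l))
    (N := (N - n).toNat) fun l hl => by rw [hf _ (by omega), smul_zero]
  simp only [smul_smul, mul_comm _ ((-1 : ℂ) ^ _)] at h
  rw [expand, h, sub_eq_add_neg, expand, expand, ← finsum_neg_distrib]
  congr 1
  · exact finsum_congr fun l => by rw [show m + (k + 1) - (l : ℤ) = m + 1 + k - l by ring]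
  · refine finsum_congr fun l => ?_
    rw [pow_succ, show m + (k + 1) - ((l + 1 : ℕ) : ℤ) = m + k - l by push_cast; ring,
      show n + ((l + 1 : ℕ) : ℤ) = n + 1 + l by push_cast; ring]
    simp

theorem expand_add {f g : ℤ → ℤ → E} {N N' : ℤ} (hf : ∀ n ≥ N, ∀ m, f m n = 0)
    (hg : ∀ n ≥ N', ∀ m, g m n = 0) (k m n : ℤ) :
    expand k (fun m n => f m n + g m n) m n = expand k f m n + expand k g m n := by
  simp only [expand, smul_add]
  exact finsum_add_distrib (expand_finite hf k m n) (expand_finite hg k m n)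

theorem expand_smul (c : ℂ) (f : ℤ → ℤ → E) (k m n : ℤ) :
    expand k (fun m n => c • f m n) m n = c • expand k f m n := by
  simp only [expand, smul_finsum]
  exact finsum_congr fun l => smul_comm _ _ _

/-- Multiplication by `z₁ - z₂`. -/
def mulDiff : Module.End ℂ (ℤ → ℤ → E) where
  toFun f := fun m n => f (m + 1) n - f m (n + 1)
  map_add' f g := by ext; simp; abel
  map_smul' c f := by ext; simp [smul_sub]

theorem mulDiff_apply (f : ℤ → ℤ → E) (m n : ℤ) :
    mulDiff f m n = f (m + 1) n - f m (n + 1) := rfl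

theorem sum_choose_succ (N : ℕ) (g : ℕ → E) :
    ∑ k ∈ Finset.range (N + 2), ((N + 1).choose k : ℂ) • g k =
      ∑ k ∈ Finset.range (N + 1), (N.choose k : ℂ) • g k +
        ∑ k ∈ Finset.range (N + 1), (N.choose k : ℂ) • g (k + 1) := by
  rw [Finset.sum_range_succ', Finset.sum_range_succ' (fun k => (N.choose k : ℂ) • g k),
    add_right_comm]
  simp only [Nat.choose_succ_succ, Nat.cast_add, add_smul, Finset.sum_add_distrib]
  rw [Finset.sum_range_succ (fun k => (N.choose (k + 1) : ℂ) • g (k + 1)),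
    Nat.choose_succ_self, Nat.cast_zero, zero_smul, add_zero, Nat.choose_zero_right,
    Nat.choose_zero_right]
  abel

theorem mulDiff_pow_apply (N : ℕ) (f : ℤ → ℤ → E) (m n : ℤ) :
    (mulDiff ^ N) f m n =
      ∑ k ∈ Finset.range (N + 1), ((-1 : ℂ) ^ k * (N.choose k : ℂ)) • f (m + N - k) (n + k) := by
  induction N generalizing m n with
  | zero => simp
  | succ N ih =>
    have h := sum_choose_succ N
      fun k : ℕ => (-1 : ℂ) ^ k • f (m + (N + 1 : ℕ) - k) (n + k)
    simp only [smul_smul, mul_comm _ ((-1 : ℂ) ^ _)] at h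
    rw [h, pow_succ', Module.End.mul_apply, mulDiff_apply, ih, ih, sub_eq_add_neg,
      ← Finset.sum_neg_distrib]
    congr 1
    · refine Finset.sum_congr rfl fun k _ => ?_
      rw [show m + ((N + 1 : ℕ) : ℤ) - k = m + 1 + N - k by push_cast; ring]
    · refine Finset.sum_congr rfl fun k _ => ?_
      rw [show m + ((N + 1 : ℕ) : ℤ) - ((k + 1 : ℕ) : ℤ) = m + N - k by push_cast; ring,
        show n + ((k + 1 : ℕ) : ℤ) = n + 1 + k by push_cast; ring, pow_succ]
      simp

theorem mulDiff_pow_eq_zero_of_le {f : ℤ → ℤ → E} {N N' : ℕ} (h : (mulDiff ^ N) f = 0)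
    (hN : N ≤ N') : (mulDiff ^ N') f = 0 := by
  rw [← Nat.sub_add_cancel hN, pow_add, Module.End.mul_apply, h, map_zero]

end Expansion

/-! ## Formal series in three variables -/

section ThreeVariables

variable {E : Type*} [AddCommGroup E] [Module ℂ E]

/-- Multiplication by `z₁ - z₂` on formal series in three variables. -/
def mulDiff₁₂ : Module.End ℂ (ℤ → ℤ → ℤ → E) where
  toFun f := fun p m n => f (p + 1) m n - f p (m + 1) n
  map_add' f g := by ext; simp; abel
  map_smul' c f := by ext; simp [smul_sub]

/-- Multiplication by `z₁ - z₃` on formal series in three variables. -/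
def mulDiff₁₃ : Module.End ℂ (ℤ → ℤ → ℤ → E) where
  toFun f := fun p m n => f (p + 1) m n - f p m (n + 1)
  map_add' f g := by ext; simp; abel
  map_smul' c f := by ext; simp [smul_sub]

/-- Multiplication by `z₂ - z₃` on formal series in three variables. -/
def mulDiff₂₃ : Module.End ℂ (ℤ → ℤ → ℤ → E) where
  toFun f := fun p m n => f p (m + 1) n - f p m (n + 1)
  map_add' f g := by ext; simp; abel
  map_smul' c f := by ext; simp [smul_sub]

theorem mulDiff₁₂_apply (f : ℤ → ℤ → ℤ → E) (p m n : ℤ) :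
    mulDiff₁₂ f p m n = f (p + 1) m n - f p (m + 1) n := rfl

theorem mulDiff₁₃_apply (f : ℤ → ℤ → ℤ → E) (p m n : ℤ) :
    mulDiff₁₃ f p m n = f (p + 1) m n - f p m (n + 1) := rfl

theorem mulDiff₂₃_apply (f : ℤ → ℤ → ℤ → E) (p m n : ℤ) :
    mulDiff₂₃ f p m n = f p (m + 1) n - f p m (n + 1) := rfl

theorem mulDiff₁₃_eq :
    (mulDiff₁₃ : Module.End ℂ (ℤ → ℤ → ℤ → E)) = mulDiff₁₂ + mulDiff₂₃ := by
  ext f p m n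
  simp [mulDiff₁₂_apply, mulDiff₁₃_apply, mulDiff₂₃_apply]

theorem commute_mulDiff₁₂_mulDiff₂₃ :
    Commute (mulDiff₁₂ : Module.End ℂ (ℤ → ℤ → ℤ → E)) mulDiff₂₃ := by
  refine LinearMap.ext fun f => ?_
  ext p m n
  simp only [Module.End.mul_apply, mulDiff₁₂_apply, mulDiff₂₃_apply]
  abel

theorem commute_mulDiff₁₃_mulDiff₂₃ :
    Commute (mulDiff₁₃ : Module.End ℂ (ℤ → ℤ → ℤ → E)) mulDiff₂₃ := by
  rw [mulDiff₁₃_eq]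
  exact commute_mulDiff₁₂_mulDiff₂₃.add_left (Commute.refl _)

theorem commute_mulDiff₁₂_mulDiff₁₃ :
    Commute (mulDiff₁₂ : Module.End ℂ (ℤ → ℤ → ℤ → E)) mulDiff₁₃ := by
  rw [mulDiff₁₃_eq]
  exact (Commute.refl _).add_right commute_mulDiff₁₂_mulDiff₂₃

theorem mulDiff₁₂_pow_apply (N : ℕ) (f : ℤ → ℤ → ℤ → E) (p m n : ℤ) :
    (mulDiff₁₂ ^ N) f p m n = (mulDiff ^ N) (fun p m => f p m n) p m := by
  induction N generalizing p m with
  | zero => rfl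
  | succ N ih =>
    rw [pow_succ', pow_succ', Module.End.mul_apply, Module.End.mul_apply, mulDiff₁₂_apply,
      mulDiff_apply, ih, ih]

theorem mulDiff₁₃_pow_apply (N : ℕ) (f : ℤ → ℤ → ℤ → E) (p m n : ℤ) :
    (mulDiff₁₃ ^ N) f p m n = (mulDiff ^ N) (fun p n => f p m n) p n := by
  induction N generalizing p n with
  | zero => rfl
  | succ N ih =>
    rw [pow_succ', pow_succ', Module.End.mul_apply, Module.End.mul_apply, mulDiff₁₃_apply,
      mulDiff_apply, ih, ih]

theorem mulDiff_pow_map {E' : Type*} [AddCommGroup E'] [Module ℂ E'] (L : E →ₗ[ℂ] E') (N : ℕ)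
    (f : ℤ → ℤ → E) (m n : ℤ) :
    (mulDiff ^ N) (fun m n => L (f m n)) m n = L ((mulDiff ^ N) f m n) := by
  simp [mulDiff_pow_apply]

theorem mulDiff₁₂_pow_map {E' : Type*} [AddCommGroup E'] [Module ℂ E'] (L : E →ₗ[ℂ] E') (i : ℕ)
    (f : ℤ → ℤ → ℤ → E) :
    (mulDiff₁₂ ^ i) (fun p m n => L (f p m n)) = fun p m n => L ((mulDiff₁₂ ^ i) f p m n) := by
  ext p m n
  rw [mulDiff₁₂_pow_apply, mulDiff₁₂_pow_apply, mulDiff_pow_map]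

theorem mulDiff₁₃_pow_map {E' : Type*} [AddCommGroup E'] [Module ℂ E'] (L : E →ₗ[ℂ] E') (i : ℕ)
    (f : ℤ → ℤ → ℤ → E) :
    (mulDiff₁₃ ^ i) (fun p m n => L (f p m n)) = fun p m n => L ((mulDiff₁₃ ^ i) f p m n) := by
  ext p m n
  rw [mulDiff₁₃_pow_apply, mulDiff₁₃_pow_apply, mulDiff_pow_map]

/-- The coefficients of `f` vanish far out in the direction `(0, s, -s)`. -/
def VanishesAlong (s : ℤ) (f : ℤ → ℤ → ℤ → E) : Prop :=
  ∀ p m n, ∀ᶠ r : ℕ in Filter.atTop, f p (m + s * r) (n - s * r) = 0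

/-- The factors `z₁ - z₂` and `z₁ - z₃` mix neighbouring values of `p`, while truncation bounds
depend on `p`. The condition is therefore an eventual one, pointwise in `p`. -/
theorem VanishesAlong.mulDiff₁₂ {s : ℤ} {f : ℤ → ℤ → ℤ → E} (hf : VanishesAlong s f) :
    VanishesAlong s (mulDiff₁₂ f) := by
  intro p m n
  filter_upwards [hf (p + 1) m n, hf p (m + 1) n] with r h1 h2
  rw [mulDiff₁₂_apply, h1, add_right_comm, h2, sub_zero]

theorem VanishesAlong.mulDiff₁₃ {s : ℤ} {f : ℤ → ℤ → ℤ → E} (hf : VanishesAlong s f) :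
    VanishesAlong s (mulDiff₁₃ f) := by
  intro p m n
  filter_upwards [hf (p + 1) m n, hf p m (n + 1)] with r h1 h2
  rw [mulDiff₁₃_apply, h1, sub_add_eq_add_sub, h2, sub_zero]

theorem VanishesAlong.mul_pow {s : ℤ} {f : ℤ → ℤ → ℤ → E} (hf : VanishesAlong s f)
    (i j : ℕ) : VanishesAlong s ((VertexLie.mulDiff₁₂ ^ i * VertexLie.mulDiff₁₃ ^ j :
      Module.End ℂ (ℤ → ℤ → ℤ → E)) f) := by
  have h : VanishesAlong s ((VertexLie.mulDiff₁₃ ^ j : Module.End ℂ (ℤ → ℤ → ℤ → E)) f) := by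
    induction j with
    | zero => exact hf
    | succ j ih => rw [pow_succ', Module.End.mul_apply]; exact ih.mulDiff₁₃
  rw [Module.End.mul_apply]
  induction i with
  | zero => exact h
  | succ i ih => rw [pow_succ', Module.End.mul_apply]; exact ih.mulDiff₁₂

/-- The annihilator commutes with `z₂ - z₃`, so its values on `X k` again form a family linked by
`z₂ - z₃`. It vanishes at `k = 0` and, by `VanishesAlong`, somewhere on each antidiagonal in the
last two variables. -/
theorem mul_pow_family_eq_zero {X : ℤ → ℤ → ℤ → ℤ → E} {s : ℤ}
    (hX : ∀ k, X (k + 1) = mulDiff₂₃ (X k)) (hs : ∀ k, VanishesAlong s (X k)) {i j : ℕ}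
    (h0 : (mulDiff₁₂ ^ i * mulDiff₁₃ ^ j : Module.End ℂ (ℤ → ℤ → ℤ → E)) (X 0) = 0) (k : ℤ) :
    (mulDiff₁₂ ^ i * mulDiff₁₃ ^ j : Module.End ℂ (ℤ → ℤ → ℤ → E)) (X k) = 0 := by
  have hc : Commute (mulDiff₁₂ ^ i * mulDiff₁₃ ^ j : Module.End ℂ (ℤ → ℤ → ℤ → E)) mulDiff₂₃ :=
    (commute_mulDiff₁₂_mulDiff₂₃.pow_left i).mul_left (commute_mulDiff₁₃_mulDiff₂₃.pow_left j)
  ext p m n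
  refine family_eq_zero (H := fun k => (mulDiff₁₂ ^ i * mulDiff₁₃ ^ j :
    Module.End ℂ (ℤ → ℤ → ℤ → E)) (X k) p) (fun k m n => ?_) (fun m n => ?_)
    (fun k m n => ?_) k m n
  · rw [hX, ← Module.End.mul_apply, hc.eq, Module.End.mul_apply, mulDiff₂₃_apply]
  · rw [h0]; rfl
  · obtain ⟨r, hr⟩ := ((hs k).mul_pow i j p m n).exists
    exact ⟨_, hr⟩

/-- The combinatorial core of Dong's lemma. Writing `z₁ - z₃ = (z₁ - z₂) + (z₂ - z₃)`, each extra
factor `z₁ - z₃` either adds a factor `z₁ - z₂` or raises `k`; after enough factors one of the two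
kills the term. -/
theorem mulDiff₁₃_pow_family {G : ℤ → ℤ → ℤ → ℤ → E}
    (hG : ∀ k, G (k + 1) = mulDiff₂₃ (G k)) {N N' : ℕ} (hN : ∀ k : ℤ, N ≤ k → G k = 0)
    (h : ∀ k, (mulDiff₁₂ ^ N' * mulDiff₁₃ ^ N' : Module.End ℂ (ℤ → ℤ → ℤ → E)) (G k) = 0)
    (k : ℤ) : ∃ K : ℕ, (mulDiff₁₃ ^ K) (G k) = 0 := by
  have hc := commute_mulDiff₁₂_mulDiff₁₃ (E := E)
  -- Here `N' - j` is the missing number of factors `z₁ - z₂` and `N - k` the distance to the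
  -- vanishing range. When their sum is at most `0`, one of `j ≥ N'`, `k ≥ N` holds.
  have key : ∀ (d j : ℕ) (k : ℤ), (N' : ℤ) - j + (N - k) ≤ d →
      (mulDiff₁₂ ^ j * mulDiff₁₃ ^ (N' + d) : Module.End ℂ (ℤ → ℤ → ℤ → E)) (G k) = 0 := by
    intro d
    induction d with
    | zero =>
      intro j k hjk
      by_cases hk : (N : ℤ) ≤ k
      · rw [hN k hk, map_zero]
      · obtain ⟨j, rfl⟩ := Nat.exists_eq_add_of_le (show N' ≤ j by omega)
        rw [add_comm N' j, pow_add, mul_assoc, add_zero, Module.End.mul_apply, h, map_zero]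
    | succ d ih =>
      intro j k hjk
      -- One factor `z₁ - z₃` is split into its two summands; each resulting term has total
      -- deficiency lower by one.
      have e : (mulDiff₁₂ ^ j * mulDiff₁₃ ^ (N' + (d + 1)) : Module.End ℂ (ℤ → ℤ → ℤ → E)) =
          mulDiff₁₂ ^ (j + 1) * mulDiff₁₃ ^ (N' + d) +
            mulDiff₁₂ ^ j * mulDiff₁₃ ^ (N' + d) * mulDiff₂₃ := by
        rw [← add_assoc, pow_succ, ← mul_assoc]
        conv_lhs => rw [mulDiff₁₃_eq, mul_add, ← mulDiff₁₃_eq]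
        congr 1
        rw [mul_assoc, ← (hc.pow_right _).eq, ← mul_assoc, ← pow_succ]
      rw [e, LinearMap.add_apply, Module.End.mul_apply _ mulDiff₂₃, ← hG,
        ih _ _ (by push_cast at hjk ⊢; omega), ih _ _ (by push_cast at hjk ⊢; omega), add_zero]
  -- Starting with no factor `z₁ - z₂`, the deficiency is `N' + (N - k)`.
  have := key ((N' : ℤ) + (N - k)).toNat 0 k (by push_cast; omega)
  exact ⟨_, by simpa using this⟩

end ThreeVariables

/-! ## Locality and products of formal series -/

section Products

variable {M : Type*} [AddCommGroup M] [Module ℂ M]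

/-- The coefficients of `a(z₁) b(z₂) - ε b(z₂) a(z₁)`. -/
def superComm (ε : ℂ) (a b : FormalSeries M) : ℤ → ℤ → Module.End ℂ M :=
  fun m n => a m * b n - ε • (b n * a m)

theorem superComm_apply (ε : ℂ) (a b : FormalSeries M) (m n : ℤ) (w : M) :
    superComm ε a b m n w = a m (b n w) - ε • b n (a m w) := rfl

theorem superComm_add_right (ε : ℂ) (a b b' : FormalSeries M) :
    superComm ε a (b + b') = superComm ε a b + superComm ε a b' := by
  ext
  simp [superComm]
  module

theorem superComm_smul_right (ε c : ℂ) (a b : FormalSeries M) :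
    superComm ε a (c • b) = c • superComm ε a b := by
  ext
  simp [superComm]
  module

/-- The series `b(z)` with `(z₁ - z₂)^N (a(z₁) b(z₂) - ε b(z₂) a(z₁)) = 0` for some `N`. -/
def localTo (ε : ℂ) (a : FormalSeries M) : Submodule ℂ (FormalSeries M) where
  carrier := {b | ∃ N : ℕ, (mulDiff ^ N) (superComm ε a b) = 0}
  zero_mem' := ⟨0, by ext; simp [superComm]⟩
  add_mem' := by
    rintro b b' ⟨N, hN⟩ ⟨N', hN'⟩
    refine ⟨max N N', ?_⟩
    rw [superComm_add_right, map_add, mulDiff_pow_eq_zero_of_le hN (le_max_left _ _),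
      mulDiff_pow_eq_zero_of_le hN' (le_max_right _ _), add_zero]
  smul_mem' := by
    rintro c b ⟨N, hN⟩
    exact ⟨N, by rw [superComm_smul_right, map_smul, hN, smul_zero]⟩

theorem mutuallyLocal_iff {i j : ZMod 2} {a b : FormalSeries M} :
    MutuallyLocal i j a b ↔ b ∈ localTo (superSign i j) a := by
  refine exists_congr fun N => ?_
  simp only [funext_iff, mulDiff_pow_apply, superComm, smul_sub, Finset.sum_sub_distrib,
    Pi.zero_apply, sub_eq_zero, Finset.smul_sum, smul_comm (superSign i j)]

theorem mulDiff_pow_flip {E : Type*} [AddCommGroup E] [Module ℂ E] (N : ℕ) (f : ℤ → ℤ → E)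
    (m n : ℤ) : (mulDiff ^ N) (fun n m => f m n) n m = (-1 : ℂ) ^ N • (mulDiff ^ N) f m n := by
  induction N generalizing m n with
  | zero => simp
  | succ N ih =>
    rw [pow_succ' mulDiff, Module.End.mul_apply, mulDiff_apply, ih, ih, Module.End.mul_apply,
      mulDiff_apply, pow_succ]
    module

theorem localTo_symm {ε : ℂ} (hε : ε * ε = 1) {a b : FormalSeries M} (h : b ∈ localTo ε a) :
    a ∈ localTo ε b := by
  obtain ⟨N, hN⟩ := h
  have e : superComm ε b a = -ε • fun n m => superComm ε a b m n := by
    ext n m w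
    simp only [superComm_apply, Pi.smul_apply, LinearMap.smul_apply, smul_sub, smul_smul,
      neg_mul, hε]
    module
  refine ⟨N, ?_⟩
  rw [e, map_smul]
  ext n m : 2
  rw [Pi.smul_apply, Pi.smul_apply, mulDiff_pow_flip, hN]
  simp

/-- For every `w`, one has `aₙ w = 0` for `n` sufficiently large. -/
def IsTruncated (a : FormalSeries M) : Prop := ∀ w : M, ∃ N : ℤ, ∀ n ≥ N, a n w = 0

theorem IsTruncated.comp {a b : FormalSeries M} (hb : IsTruncated b) (w : M) :
    ∃ N : ℤ, ∀ n ≥ N, ∀ m, a m (b n w) = 0 := by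
  obtain ⟨N, hN⟩ := hb w
  exact ⟨N, fun n hn m => by rw [hN n hn, map_zero]⟩

theorem expand_comp_add {a b : FormalSeries M} (hb : IsTruncated b) (w w' : M) (k m n : ℤ) :
    expand k (fun m n => a m (b n (w + w'))) m n =
      expand k (fun m n => a m (b n w)) m n + expand k (fun m n => a m (b n w')) m n := by
  obtain ⟨N, hN⟩ := hb.comp (a := a) w
  obtain ⟨N', hN'⟩ := hb.comp (a := a) w'
  simp only [map_add]
  exact expand_add hN hN' k m n

theorem expand_map {E E' : Type*} [AddCommGroup E] [Module ℂ E] [AddCommGroup E'] [Module ℂ E']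
    (L : E →ₗ[ℂ] E') {f : ℤ → ℤ → E} {N : ℤ} (hf : ∀ n ≥ N, ∀ m, f m n = 0) (k m n : ℤ) :
    L (expand k f m n) = expand k (fun m n => L (f m n)) m n := by
  simp only [expand, ← map_smul]
  exact L.toAddMonoidHom.map_finsum (expand_finite hf k m n)

/-- The commutator of an operator with an expansion is computed coefficientwise. -/
theorem map_expand_sub {a b : FormalSeries M} (hb : IsTruncated b) (δ : ℂ) (c : Module.End ℂ M)
    (w : M) (k m n : ℤ) :
    c (expand k (fun m n => a m (b n w)) m n) - δ • expand k (fun m n => a m (b n (c w))) m n =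
      expand k (fun m n => c (a m (b n w)) - δ • a m (b n (c w))) m n := by
  obtain ⟨N, hN⟩ := hb.comp (a := a) w
  obtain ⟨N', hN'⟩ := hb.comp (a := a) (c w)
  rw [expand_map c hN, sub_eq_add_neg, ← neg_smul, ← expand_smul]
  simp only [sub_eq_add_neg, ← neg_smul]
  exact (expand_add (fun n hn m => by rw [hN n hn, map_zero])
    (fun n hn m => by rw [hN' n hn, smul_zero]) k m n).symm

/-- The coefficients of
`z₀⁻¹ δ((z₁-z₂)/z₀) a(z₁) b(z₂) - ε z₀⁻¹ δ((z₂-z₁)/(-z₀)) b(z₂) a(z₁)`. -/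
def jacobiLeft (ε : ℂ) {a b : FormalSeries M} (ha : IsTruncated a) (hb : IsTruncated b)
    (k m n : ℤ) : Module.End ℂ M where
  toFun w := expand k (fun m n => a m (b n w)) m n -
    (ε * (-1 : ℂ) ^ k) • expand k (fun n m => b n (a m w)) n m
  map_add' w w' := by
    rw [expand_comp_add hb, expand_comp_add ha]
    module
  map_smul' c w := by
    simp only [map_smul]
    rw [expand_smul, expand_smul, RingHom.id_apply]
    module

variable {ε : ℂ} {a b : FormalSeries M} (ha : IsTruncated a) (hb : IsTruncated b)

theorem jacobiLeft_apply (k m n : ℤ) (w : M) :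
    jacobiLeft ε ha hb k m n w = expand k (fun m n => a m (b n w)) m n -
      (ε * (-1 : ℂ) ^ k) • expand k (fun n m => b n (a m w)) n m := rfl

theorem jacobiLeft_eq_finsum (k m n : ℤ) (w : M) :
    jacobiLeft ε ha hb k m n w = ∑ᶠ l : ℕ, ((-1 : ℂ) ^ l * ((Ring.choose k l : ℤ) : ℂ)) •
      (a (m + k - l) (b (n + l) w) - (ε * (-1 : ℂ) ^ k) • b (n + k - l) (a (m + l) w)) := by
  obtain ⟨N, hN⟩ := hb.comp (a := a) w
  obtain ⟨N', hN'⟩ := ha.comp (a := b) w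
  rw [jacobiLeft_apply, ← expand_smul]
  have h : ∀ n ≥ N', ∀ m, (ε * (-1 : ℂ) ^ k) • b m (a n w) = 0 := fun n hn m => by
    rw [hN' n hn, smul_zero]
  rw [expand, expand, ← finsum_sub_distrib (expand_finite hN k m n) (expand_finite h k n m)]
  simp only [smul_sub]

/-- The part of `jacobiLeft` with the factors in the order `b`, `a`. -/
def expandSwap (k : ℤ) (f : ℤ → ℤ → M) (m n : ℤ) : M :=
  (-1 : ℂ) ^ k • expand k (fun n m => f m n) n m

theorem expandSwap_succ {f : ℤ → ℤ → M} {N : ℤ} (hf : ∀ m ≥ N, ∀ n, f m n = 0) (k m n : ℤ) :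
    expandSwap (k + 1) f m n = expandSwap k f (m + 1) n - expandSwap k f m (n + 1) := by
  rw [expandSwap, expand_succ (f := fun n m => f m n) hf, zpow_add_one₀ (by norm_num),
    expandSwap, expandSwap]
  module

theorem jacobiLeft_apply' (k m n : ℤ) (w : M) :
    jacobiLeft ε ha hb k m n w = expand k (fun m n => a m (b n w)) m n -
      ε • expandSwap k (fun m n => b n (a m w)) m n := by
  rw [jacobiLeft_apply, mul_smul]
  rfl

theorem jacobiLeft_succ (k m n : ℤ) :
    jacobiLeft ε ha hb (k + 1) m n =
      jacobiLeft ε ha hb k (m + 1) n - jacobiLeft ε ha hb k m (n + 1) := by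
  ext w
  obtain ⟨N, hN⟩ := hb.comp (a := a) w
  obtain ⟨N', hN'⟩ := ha.comp (a := b) w
  rw [LinearMap.sub_apply, jacobiLeft_apply', jacobiLeft_apply', jacobiLeft_apply',
    expand_succ hN, expandSwap_succ hN']
  module

theorem jacobiLeft_zero (m n : ℤ) : jacobiLeft ε ha hb 0 m n = superComm ε a b m n := by
  ext w
  simp [jacobiLeft_apply, superComm_apply, expand_zero]

/-- For `k ≥ 0` the two expansions are the same polynomial `(z₁ - z₂)^k`, the sign `(-1)^k` turning
`z₂ - z₁` around. Locality thus becomes vanishing for large `k`. -/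
theorem jacobiLeft_natCast (k : ℕ) (m n : ℤ) :
    jacobiLeft ε ha hb k m n = (mulDiff ^ k) (superComm ε a b) m n := by
  induction k generalizing m n with
  | zero => exact jacobiLeft_zero ha hb m n
  | succ k ih =>
    rw [Nat.cast_succ, jacobiLeft_succ, ih, ih, pow_succ', Module.End.mul_apply, mulDiff_apply]

theorem jacobiLeft_eq_zero {N : ℕ} (hN : (mulDiff ^ N) (superComm ε a b) = 0) {k : ℤ}
    (hk : N ≤ k) (m n : ℤ) : jacobiLeft ε ha hb k m n = 0 := by
  lift k to ℕ using by omega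
  rw [jacobiLeft_natCast, mulDiff_pow_eq_zero_of_le hN (by omega)]
  rfl

/-- The product `a(z)₍ₖ₎ b(z)` of formal series. -/
def nprod (ε : ℂ) {a b : FormalSeries M} (ha : IsTruncated a) (hb : IsTruncated b) (k : ℤ) :
    FormalSeries M := fun n => jacobiLeft ε ha hb k 0 n

theorem nprod_apply (k n : ℤ) : nprod ε ha hb k n = jacobiLeft ε ha hb k 0 n := rfl

theorem isTruncated_nprod (k : ℤ) : IsTruncated (nprod ε ha hb k) := by
  intro w
  obtain ⟨N, hN⟩ := hb.comp (a := a) w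
  obtain ⟨K, hK⟩ := ha w
  -- Only finitely many `a l w` with `l ≥ 0` are nonzero, so finitely many truncation bounds for `b`
  -- suffice.
  have h : ∀ᶠ n : ℤ in Filter.atTop, ∀ l ∈ Finset.range K.toNat, b (n + k - l) (a l w) = 0 := by
    rw [Filter.eventually_all_finset]
    intro l _
    obtain ⟨N', hN'⟩ := hb (a l w)
    filter_upwards [Filter.eventually_ge_atTop (N' - k + l)] with n hn
    exact hN' _ (by omega)
  obtain ⟨N', hN'⟩ := Filter.eventually_atTop.1 h
  refine ⟨max N N', fun n hn => ?_⟩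
  rw [nprod_apply, jacobiLeft_apply, expand_eq_zero hN (le_trans (le_max_left _ _) hn), expand,
    finsum_eq_zero_of_forall_eq_zero, smul_zero, sub_zero]
  intro l
  rw [zero_add]
  by_cases hl : l ∈ Finset.range K.toNat
  · rw [hN' n (le_trans (le_max_right _ _) hn) l hl, smul_zero]
  · rw [hK l (by rw [Finset.mem_range] at hl; omega), map_zero, smul_zero]

/-- **Dong's lemma**. -/
theorem nprod_mem_localTo {ε₂ ε₃ : ℂ} {c : FormalSeries M} (hab : b ∈ localTo ε a)
    (hca : a ∈ localTo ε₂ c) (hcb : b ∈ localTo ε₃ c) (k : ℤ) :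
    nprod ε ha hb k ∈ localTo (ε₂ * ε₃) c := by
  obtain ⟨N, hN⟩ := hab
  obtain ⟨N₂, hN₂⟩ := hca
  obtain ⟨N₃, hN₃⟩ := hcb
  replace hN₂ := mulDiff_pow_eq_zero_of_le hN₂ (le_max_left N₂ N₃)
  replace hN₃ := mulDiff_pow_eq_zero_of_le hN₃ (le_max_right N₂ N₃)
  set N' := max N₂ N₃
  have hc := (commute_mulDiff₁₂_mulDiff₁₃ (E := M)).pow_pow N' N'
  -- The supercommutator of `c(z₁)` with the whole generating function in `z₂`, `z₃` is used, rather
  -- than with its residue: only the former satisfies the recursion in `k`.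
  let G : ℤ → ℤ → ℤ → ℤ → Module.End ℂ M := fun k p m n =>
    c p * jacobiLeft ε ha hb k m n - (ε₂ * ε₃) • (jacobiLeft ε ha hb k m n * c p)
  have hG : ∀ k, G (k + 1) = mulDiff₂₃ (G k) := by
    intro k
    ext p m n w
    simp only [G, mulDiff₂₃_apply, jacobiLeft_succ, LinearMap.sub_apply, Module.End.mul_apply,
      LinearMap.smul_apply, map_sub]
    module
  have hcomp : ∀ (f : FormalSeries M) (δ : ℂ), (mulDiff ^ N') (superComm δ c f) = 0 →
      ∀ (L : Module.End ℂ M →ₗ[ℂ] M) (p m : ℤ),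
        (mulDiff ^ N') (fun p m => L (superComm δ c f p m)) p m = 0 := by
    intro f δ hf L p m
    rw [mulDiff_pow_map, hf]
    simp
  have hkill : ∀ g g' : ℤ → ℤ → ℤ → M, (mulDiff₁₂ ^ N') g = 0 → (mulDiff₁₃ ^ N') g' = 0 →
      (mulDiff₁₂ ^ N' * mulDiff₁₃ ^ N' : Module.End ℂ (ℤ → ℤ → ℤ → M)) (g + g') = 0 := by
    intro g g' hg hg'
    rw [map_add, hc.eq, Module.End.mul_apply, hg, map_zero, ← hc.eq, Module.End.mul_apply, hg',
      map_zero, add_zero]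
  have hfirst : ∀ w k, (mulDiff₁₂ ^ N' * mulDiff₁₃ ^ N' : Module.End ℂ (ℤ → ℤ → ℤ → M))
      (fun p => expand k (fun m n => c p (a m (b n w)) - (ε₂ * ε₃) • a m (b n (c p w)))) = 0 := by
    intro w k
    -- The bound may depend on `p`, since it involves `c p w`; `z₂ - z₃` leaves `p` fixed, so the
    -- recursion in `k` is unaffected.
    have htr : ∀ p, ∃ K : ℤ, ∀ n ≥ K, ∀ m,
        c p (a m (b n w)) - (ε₂ * ε₃) • a m (b n (c p w)) = 0 := by
      intro p
      obtain ⟨K, hK⟩ := hb w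
      obtain ⟨K', hK'⟩ := hb (c p w)
      refine ⟨max K K', fun n hn m => ?_⟩
      rw [hK n (le_trans (le_max_left _ _) hn), hK' n (le_trans (le_max_right _ _) hn)]
      simp
    refine mul_pow_family_eq_zero (s := -1) (X := fun k p => expand k (fun m n =>
      c p (a m (b n w)) - (ε₂ * ε₃) • a m (b n (c p w)))) (fun k => ?_) (fun k p m n => ?_) ?_ k
    · ext p m n
      obtain ⟨K, hK⟩ := htr p
      rw [mulDiff₂₃_apply, expand_succ hK]
    · obtain ⟨K, hK⟩ := htr p
      filter_upwards [Filter.eventually_ge_atTop (K - n).toNat] with r hr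
      exact expand_eq_zero hK (by omega) _ _
    -- Leibniz rule `[c, ab] = [c, a] b + ε₂ a [c, b]`: the first term is killed by a power of `z₁ -
    -- z₂`, the second by a power of `z₁ - z₃`.
    · have e : (fun p => expand 0 (fun m n =>
          c p (a m (b n w)) - (ε₂ * ε₃) • a m (b n (c p w)))) =
          (fun p m n => LinearMap.applyₗ (b n w) (superComm ε₂ c a p m)) +
            ε₂ • fun p m n => (a m ∘ₗ LinearMap.applyₗ w) (superComm ε₃ c b p n) := by
        ext p m n
        simp [expand_zero, superComm_apply]
        module
      rw [e]
      refine hkill _ _ ?_ ?_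
      · ext p m n
        rw [mulDiff₁₂_pow_apply, hcomp a ε₂ hN₂]
        rfl
      · rw [map_smul]
        ext p m n
        rw [Pi.smul_apply, Pi.smul_apply, Pi.smul_apply, mulDiff₁₃_pow_apply, hcomp b ε₃ hN₃,
          smul_zero]
        rfl
  have hsecond : ∀ w k, (mulDiff₁₂ ^ N' * mulDiff₁₃ ^ N' : Module.End ℂ (ℤ → ℤ → ℤ → M))
      (fun p => expandSwap k
        (fun m n => c p (b n (a m w)) - (ε₂ * ε₃) • b n (a m (c p w)))) = 0 := by
    intro w k
    have htr : ∀ p, ∃ K : ℤ, ∀ m ≥ K, ∀ n,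
        c p (b n (a m w)) - (ε₂ * ε₃) • b n (a m (c p w)) = 0 := by
      intro p
      obtain ⟨K, hK⟩ := ha w
      obtain ⟨K', hK'⟩ := ha (c p w)
      refine ⟨max K K', fun n hn m => ?_⟩
      rw [hK n (le_trans (le_max_left _ _) hn), hK' n (le_trans (le_max_right _ _) hn)]
      simp
    refine mul_pow_family_eq_zero (s := 1) (X := fun k p => expandSwap k (fun m n =>
      c p (b n (a m w)) - (ε₂ * ε₃) • b n (a m (c p w)))) (fun k => ?_) (fun k p m n => ?_) ?_ k
    · ext p m n
      obtain ⟨K, hK⟩ := htr p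
      rw [mulDiff₂₃_apply, expandSwap_succ hK]
    · obtain ⟨K, hK⟩ := htr p
      filter_upwards [Filter.eventually_ge_atTop (K - m).toNat] with r hr
      have := expand_eq_zero (f := fun n m => c p (b n (a m w)) - (ε₂ * ε₃) • b n (a m (c p w)))
        hK (show K ≤ m + 1 * r by omega) k (n - 1 * r)
      rw [expandSwap, this, smul_zero]
    -- The same rule for the opposite order: `[c, ba] = ε₃ b [c, a] + [c, b] a`.
    · have e : (fun p => expandSwap 0 (fun m n =>
          c p (b n (a m w)) - (ε₂ * ε₃) • b n (a m (c p w)))) =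
          (ε₃ • fun p m n => (b n ∘ₗ LinearMap.applyₗ w) (superComm ε₂ c a p m)) +
            fun p m n => LinearMap.applyₗ (a m w) (superComm ε₃ c b p n) := by
        ext p m n
        simp [expandSwap, expand_zero, superComm_apply]
        module
      rw [e]
      refine hkill _ _ ?_ ?_
      · rw [map_smul]
        ext p m n
        rw [Pi.smul_apply, Pi.smul_apply, Pi.smul_apply, mulDiff₁₂_pow_apply, hcomp a ε₂ hN₂,
          smul_zero]
        rfl
      · ext p m n
        rw [mulDiff₁₃_pow_apply, hcomp b ε₃ hN₃]
        rfl
  have hGw : ∀ w k, (fun p m n => LinearMap.applyₗ w (G k p m n)) =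
      (fun p => expand k (fun m n => c p (a m (b n w)) - (ε₂ * ε₃) • a m (b n (c p w)))) -
        ε • fun p => expandSwap k
          (fun m n => c p (b n (a m w)) - (ε₂ * ε₃) • b n (a m (c p w))) := by
    intro w k
    ext p m n
    simp only [G, LinearMap.applyₗ_apply_apply,
      Module.End.mul_apply, jacobiLeft_apply', expandSwap, Pi.sub_apply, Pi.smul_apply,
      ← map_expand_sub hb, ← map_expand_sub ha, map_sub, map_smul]
    module
  have hGk : ∀ k, (mulDiff₁₂ ^ N' * mulDiff₁₃ ^ N' :
      Module.End ℂ (ℤ → ℤ → ℤ → Module.End ℂ M)) (G k) = 0 := by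
    intro k
    ext p m n w
    have h := congrFun₃ (congrArg (mulDiff₁₂ ^ N' * mulDiff₁₃ ^ N' :
      Module.End ℂ (ℤ → ℤ → ℤ → M)) (hGw w k)) p m n
    rw [map_sub, map_smul, hfirst, hsecond, Module.End.mul_apply, mulDiff₁₃_pow_map,
      mulDiff₁₂_pow_map] at h
    simpa using h
  -- Locality of `a` and `b` enters here: it makes `G k` vanish for `k ≥ N`.
  obtain ⟨K, hK⟩ := mulDiff₁₃_pow_family hG (N := N) (fun k hk => by
    ext p m n : 3
    simp [G, jacobiLeft_eq_zero ha hb hN hk]) hGk k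
  refine ⟨K, ?_⟩
  ext p n : 2
  -- The product is the slice `m = 0`, and `z₁ - z₃` does not move `m`, so the annihilation
  -- restricts to it.
  have h := congrFun₃ hK p 0 n
  rwa [mulDiff₁₃_pow_apply] at h

end Products

section Products

variable {M : Type*} [AddCommGroup M] [Module ℂ M]

/-! ## The Jacobi identity for local series -/

section Jacobi

variable {ε : ℂ} {a b : FormalSeries M} (ha : IsTruncated a) (hb : IsTruncated b)

/-- Local series satisfy the Jacobi identity for the products of series. -/
theorem jacobiLeft_eq_finsum_nprod (hab : b ∈ localTo ε a) (k m n : ℤ) (w : M) :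
    jacobiLeft ε ha hb k m n w =
      ∑ᶠ l : ℕ, ((Ring.choose m l : ℤ) : ℂ) • nprod ε ha hb (k + l) (m + n - l) w := by
  obtain ⟨N, hN⟩ := hab
  have hz : ∀ k : ℤ, N ≤ k → ∀ m n, jacobiLeft ε ha hb k m n w = 0 := fun k hk m n => by
    rw [jacobiLeft_eq_zero ha hb hN hk, LinearMap.zero_apply]
  -- The right side satisfies the same recursion as the left (`z₁ = z₀ + z₂`, by Pascal's rule) and
  -- agrees with it at `m = 0`. It remains to see that these data determine all `m`.
  let R : ℤ → ℤ → ℤ → M := fun k m n =>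
    ∑ᶠ l : ℕ, ((Ring.choose m l : ℤ) : ℂ) • jacobiLeft ε ha hb (k + l) 0 (m + n - l) w
  have hR : ∀ k m n, R k (m + 1) n = R (k + 1) m n + R k m (n + 1) := by
    intro k m n
    have h := choose_succ_finsum m
      (fun l : ℕ => jacobiLeft ε ha hb (k + l) 0 (m + 1 + n - l) w)
      (N := (N - k).toNat) fun l hl => hz _ (by omega) _ _
    simp only [R]
    rw [h, add_comm]
    congr 1
    · refine finsum_congr fun l => ?_
      rw [show k + ((l + 1 : ℕ) : ℤ) = k + 1 + l by push_cast; ring,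
        show m + 1 + n - ((l + 1 : ℕ) : ℤ) = m + n - l by push_cast; ring]
    · refine finsum_congr fun l => ?_
      rw [show m + 1 + n = m + (n + 1) by ring]
  have hR0 : ∀ k n, R k 0 n = jacobiLeft ε ha hb k 0 n w := by
    intro k n
    simp only [R]
    rw [finsum_eq_single _ 0]
    · simp
    · intro l hl
      rw [Ring.choose_zero_pos ℤ (Nat.pos_of_ne_zero hl)]
      simp
  have hRz : ∀ k : ℤ, N ≤ k → ∀ m n, R k m n = 0 := fun k hk m n =>
    finsum_eq_zero_of_forall_eq_zero fun l => by rw [hz _ (by omega), smul_zero]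
  suffices h : ∀ m k n, jacobiLeft ε ha hb k m n w - R k m n = 0 from sub_eq_zero.1 (h m k n)
  have hsucc : ∀ m k n, jacobiLeft ε ha hb (k + 1) m n w - R (k + 1) m n =
      (jacobiLeft ε ha hb k (m + 1) n w - R k (m + 1) n) -
        (jacobiLeft ε ha hb k m (n + 1) w - R k m (n + 1)) := by
    intro m k n
    rw [jacobiLeft_succ, hR, LinearMap.sub_apply]
    abel
  intro m
  induction m using Int.induction_on with
  | zero => intro k n; rw [hR0, sub_self]
  | succ m ih =>
    intro k n
    have h := hsucc m k n
    rw [ih, ih, sub_zero] at h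
    exact h.symm
  | pred m ih =>
    -- To lower `m`, the recursion expresses the difference at `k` through that at `k + 1`. Both
    -- sides vanish for `k ≥ N`, so descending induction on `k` starts there.
    have key : ∀ (d : ℕ) (k n : ℤ), N ≤ k + d →
        jacobiLeft ε ha hb k (-(m : ℤ) - 1) n w - R k (-(m : ℤ) - 1) n = 0 := by
      intro d
      induction d with
      | zero =>
        intro k n hk
        rw [hz k (by omega), hRz k (by omega), sub_zero]
      | succ d ihd =>
        intro k n hk
        have h := hsucc (-(m : ℤ) - 1) k (n - 1)
        rw [ihd (k + 1) _ (by omega), sub_add_cancel, sub_add_cancel, ih, zero_sub] at h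
        exact neg_eq_zero.1 h.symm
    intro k n
    exact key (N - k).toNat k n (by omega)

/-- The operator `∂₁ + ∂₂` kills `z₁ - z₂`, hence commutes with multiplication by its powers and
with their expansions. The signs of both derivatives are reversed here. -/
theorem expand_derivative {E : Type*} [AddCommGroup E] [Module ℂ E] {f : ℤ → ℤ → E} {N : ℤ}
    (hf : ∀ n ≥ N, ∀ m, f m n = 0) (k m n : ℤ) :
    expand k (fun (m n : ℤ) => (m : ℂ) • f (m - 1) n + (n : ℂ) • f m (n - 1)) m n =
      (m : ℂ) • expand k f (m - 1) n + (n : ℂ) • expand k f m (n - 1) := by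
  have hf' : ∀ n ≥ N + 1, ∀ m : ℤ, (m : ℂ) • f (m - 1) n + (n : ℂ) • f m (n - 1) = 0 :=
    fun n hn m => by rw [hf n (by omega), hf (n - 1) (by omega), smul_zero, smul_zero, add_zero]
  rw [← sub_eq_zero]
  -- The shift `n - N - 2` moves the second index to `N + 2`, where all three expansions, including
  -- the one at index one lower, are past truncation.
  refine family_eq_zero (H := fun k m n =>
    expand k (fun (m n : ℤ) => (m : ℂ) • f (m - 1) n + (n : ℂ) • f m (n - 1)) m n -
      ((m : ℂ) • expand k f (m - 1) n + (n : ℂ) • expand k f m (n - 1)))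
    (fun k m n => ?_) (fun m n => ?_) (fun k m n => ⟨n - N - 2, ?_⟩) k m n
  · rw [expand_succ hf', expand_succ hf, expand_succ hf]
    rw [sub_add_cancel, sub_add_cancel, add_sub_cancel_right, add_sub_cancel_right]
    push_cast
    module
  · simp only [expand_zero, sub_self]
  · rw [expand_eq_zero hf' (by omega), expand_eq_zero hf (by omega),
      expand_eq_zero hf (by omega)]
    simp

variable {D : Module.End ℂ M}

theorem map_expand_of_derivation {a b : FormalSeries M} (hb : IsTruncated b)
    (hDa : ∀ n : ℤ, D * a n - a n * D = -(n : ℂ) • a (n - 1))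
    (hDb : ∀ n : ℤ, D * b n - b n * D = -(n : ℂ) • b (n - 1)) (k m n : ℤ) (w : M) :
    D (expand k (fun m n => a m (b n w)) m n) - expand k (fun m n => a m (b n (D w))) m n =
      -((m : ℂ) • expand k (fun m n => a m (b n w)) (m - 1) n +
        (n : ℂ) • expand k (fun m n => a m (b n w)) m (n - 1)) := by
  obtain ⟨N, hN⟩ := hb.comp (a := a) w
  have h := map_expand_sub (a := a) hb 1 D w k m n
  rw [one_smul] at h
  rw [h, ← expand_derivative hN, ← neg_one_smul ℂ (expand _ _ _ _), ← expand_smul]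
  congr 1
  ext m n
  have h1 := LinearMap.congr_fun (hDa m) (b n w)
  have h2 := congrArg (a m) (LinearMap.congr_fun (hDb n) w)
  simp only [LinearMap.sub_apply, Module.End.mul_apply, LinearMap.smul_apply, map_sub,
    map_smul] at h1 h2
  linear_combination (norm := module) h1 + h2

/-- At `m = 0` the first term on the right drops out, which leaves `[D, a₍ₖ₎b] = (a₍ₖ₎b)'`. -/
theorem jacobiLeft_derivation (hDa : ∀ n : ℤ, D * a n - a n * D = -(n : ℂ) • a (n - 1))
    (hDb : ∀ n : ℤ, D * b n - b n * D = -(n : ℂ) • b (n - 1)) (k m n : ℤ) :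
    D * jacobiLeft ε ha hb k m n - jacobiLeft ε ha hb k m n * D =
      -((m : ℂ) • jacobiLeft ε ha hb k (m - 1) n + (n : ℂ) • jacobiLeft ε ha hb k m (n - 1)) := by
  ext w
  have h1 := map_expand_of_derivation hb hDa hDb k m n w
  have h2 := map_expand_of_derivation ha hDb hDa k n m w
  simp only [LinearMap.sub_apply, Module.End.mul_apply, LinearMap.neg_apply, LinearMap.add_apply,
    LinearMap.smul_apply, jacobiLeft_apply, map_sub, map_smul]
  linear_combination (norm := module) h1 - (ε * (-1 : ℂ) ^ k) • h2

end Jacobi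

/-! ## Creative series -/

theorem superSign_mul_self (i j : ZMod 2) : superSign i j * superSign i j = 1 := by
  rw [superSign, ← mul_pow, neg_one_mul, neg_neg, one_pow]

theorem superSign_comm (i j : ZMod 2) : superSign i j = superSign j i := by
  rw [superSign, superSign, mul_comm]

theorem superSign_zero_right (i : ZMod 2) : superSign i 0 = 1 := by
  simp [superSign]

theorem superSign_add_right (i j k : ZMod 2) :
    superSign i (j + k) = superSign i j * superSign i k := by
  rw [superSign, superSign, superSign, ← pow_add, ← mul_add, neg_one_pow_eq_pow_mod_two,
    neg_one_pow_eq_pow_mod_two (n := i.val * (j.val + k.val)), Nat.mul_mod, ZMod.val_add,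
    Nat.mod_mod, ← Nat.mul_mod]

variable {grading : ZMod 2 → Submodule ℂ M} {vac : M} {D : Module.End ℂ M}

/-- A homogeneous truncated series `a(z)` with `[D, a(z)] = a'(z)` for which `a(z) 1` is a power
series. -/
structure IsCreative (grading : ZMod 2 → Submodule ℂ M) (vac : M) (D : Module.End ℂ M)
    (i : ZMod 2) (a : FormalSeries M) : Prop where
  homogeneous : ∀ (n : ℤ) (j : ZMod 2), ∀ w ∈ grading j, a n w ∈ grading (i + j)
  truncation : IsTruncated a
  derivation : ∀ n : ℤ, D * a n - a n * D = -(n : ℂ) • a (n - 1)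
  creation : ∀ n : ℤ, 0 ≤ n → a n vac = 0

theorem finsum_mem_submodule {E : Type*} [AddCommGroup E] [Module ℂ E] (S : Submodule ℂ E)
    {f : ℕ → E} (hf : ∀ l, f l ∈ S) : ∑ᶠ l, f l ∈ S :=
  finsum_induction (· ∈ S) S.zero_mem (fun _ _ => S.add_mem) hf

theorem expand_mem {a b : FormalSeries M} {i j l : ZMod 2}
    (ha : ∀ (n : ℤ) (j : ZMod 2), ∀ w ∈ grading j, a n w ∈ grading (i + j))
    (hb : ∀ (n : ℤ) (i : ZMod 2), ∀ w ∈ grading i, b n w ∈ grading (j + i)) (k m n : ℤ) {w : M}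
    (hw : w ∈ grading l) : expand k (fun m n => a m (b n w)) m n ∈ grading (i + j + l) :=
  finsum_mem_submodule _ fun _ => Submodule.smul_mem _ _ <| by
    rw [add_assoc]
    exact ha _ _ _ (hb _ _ _ hw)

theorem IsCreative.nprod {i j : ZMod 2} {a b : FormalSeries M}
    (ha : IsCreative grading vac D i a) (hb : IsCreative grading vac D j b) (ε : ℂ) (k : ℤ) :
    IsCreative grading vac D (i + j) (nprod ε ha.truncation hb.truncation k) where
  homogeneous n l w hw := by
    refine sub_mem (expand_mem ha.homogeneous hb.homogeneous k 0 n hw)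
      (Submodule.smul_mem _ _ ?_)
    rw [add_comm i j]
    exact expand_mem hb.homogeneous ha.homogeneous k n 0 hw
  truncation := isTruncated_nprod _ _ k
  derivation n := by
    simp only [nprod_apply]
    rw [jacobiLeft_derivation _ _ ha.derivation hb.derivation]
    simp
  creation n hn := by
    rw [nprod_apply, jacobiLeft_apply,
      expand_eq_zero (fun n hn m => by rw [hb.creation n hn, map_zero]) hn,
      expand_eq_zero (fun n hn m => by rw [ha.creation n hn, map_zero]) le_rfl]
    simp

/-- On the vacuum the `b a` part vanishes, since only `aₗ` with `l ≥ 0` occur in it; in the `a b`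
part only `b₋₁` survives. Thus products of series induce products of states. -/
theorem IsCreative.nprod_vac {i j : ZMod 2} {a b : FormalSeries M}
    (ha : IsCreative grading vac D i a) (hb : IsCreative grading vac D j b) (ε : ℂ) (k : ℤ) :
    VertexLie.nprod ε ha.truncation hb.truncation k (-1) vac = a k (b (-1) vac) := by
  rw [nprod_apply, jacobiLeft_apply,
    expand_eq_zero (f := fun n m => b n (a m vac))
      (fun n hn m => by rw [ha.creation n hn, map_zero]) le_rfl,
    smul_zero, sub_zero, expand, finsum_eq_single _ 0]
  · simp
  · intro l hl
    rw [hb.creation _ (by omega), map_zero, smul_zero]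

/-- The derivative of a formal series. -/
def derivative (a : FormalSeries M) : FormalSeries M := fun n => -(n : ℂ) • a (n - 1)

theorem derivative_apply (a : FormalSeries M) (n : ℤ) :
    derivative a n = -(n : ℂ) • a (n - 1) := rfl

theorem IsCreative.derivative {i : ZMod 2} {a : FormalSeries M}
    (ha : IsCreative grading vac D i a) : IsCreative grading vac D i (derivative a) where
  homogeneous n j w hw := Submodule.smul_mem _ _ (ha.homogeneous _ _ _ hw)
  truncation w := by
    obtain ⟨N, hN⟩ := ha.truncation w
    refine ⟨N + 1, fun n hn => ?_⟩
    rw [derivative_apply, LinearMap.smul_apply, hN _ (by omega), smul_zero]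
  derivation n := by
    rw [derivative_apply, mul_smul_comm, smul_mul_assoc, ← smul_sub, ha.derivation]
    rfl
  creation n hn := by
    rw [derivative_apply, LinearMap.smul_apply]
    rcases hn.eq_or_lt with rfl | hn
    · simp
    · rw [ha.creation _ (by omega), smul_zero]

/-- Differentiation in `z₂` costs one more power of `z₁ - z₂`. -/
theorem derivative_mem_localTo {ε : ℂ} {a c : FormalSeries M} (h : a ∈ localTo ε c) :
    derivative a ∈ localTo ε c := by
  have key : ∀ (N : ℕ) (f : ℤ → ℤ → Module.End ℂ M), (mulDiff ^ N) f = 0 →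
      (mulDiff ^ (N + 1)) (fun (m n : ℤ) => -(n : ℂ) • f m (n - 1)) = 0 := by
    intro N
    induction N with
    | zero =>
      intro f hf
      have hf : f = 0 := hf
      subst hf
      ext m n
      simp [mulDiff_apply]
    | succ N ih =>
      intro f hf
      -- This is `(z₁ - z₂) ∂₂ f = ∂₂((z₁ - z₂) f) + f`.
      have e : mulDiff (fun (m n : ℤ) => -(n : ℂ) • f m (n - 1)) =
          (fun (m n : ℤ) => -(n : ℂ) • mulDiff f m (n - 1)) + f := by
        ext m n : 2
        simp only [mulDiff_apply, Pi.add_apply, add_sub_cancel_right, sub_add_cancel]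
        push_cast
        module
      rw [pow_succ, Module.End.mul_apply, e, map_add, hf, add_zero]
      rw [pow_succ, Module.End.mul_apply] at hf
      exact ih _ hf
  obtain ⟨N, hN⟩ := h
  refine ⟨N + 1, ?_⟩
  rw [← key N _ hN]
  congr 1
  ext m n : 2
  rw [superComm, superComm, derivative_apply, mul_smul_comm, smul_mul_assoc, smul_sub,
    smul_comm ε]

/-- The series `1(z) = id`. -/
def idSeries : FormalSeries M := fun n => if n = -1 then 1 else 0

theorem isCreative_idSeries : IsCreative grading vac D 0 idSeries where
  homogeneous n j w hw := by
    rw [zero_add, idSeries]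
    split_ifs
    exacts [hw, zero_mem _]
  truncation w := ⟨0, fun n hn => by rw [idSeries, if_neg (by omega), LinearMap.zero_apply]⟩
  derivation n := by
    by_cases hn : n = 0
    · simp [idSeries, hn]
    · rw [idSeries, idSeries, if_neg (show n - 1 ≠ -1 by omega), smul_zero]
      split_ifs <;> simp
  creation n hn := by rw [idSeries, if_neg (by omega), LinearMap.zero_apply]

theorem idSeries_mem_localTo (c : FormalSeries M) : idSeries ∈ localTo 1 c := by
  refine ⟨0, ?_⟩
  ext m n : 2
  rw [pow_zero, Module.End.one_apply, superComm, idSeries]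
  split_ifs <;> simp

/-- Truncation in one variable, uniform in the other, makes `z₁ - z₂` cancellable. -/
theorem eq_zero_of_mulDiff_pow {g : ℤ → ℤ → M} {K : ℤ} (hK : ∀ m ≥ K, ∀ n, g m n = 0) {N : ℕ}
    (h : (mulDiff ^ N) g = 0) : g = 0 := by
  induction N generalizing g with
  | zero => exact h
  | succ N ih =>
    rw [pow_succ, Module.End.mul_apply] at h
    have h' := ih (fun m hm n => by
      rw [mulDiff_apply, hK _ (by omega), hK _ hm, sub_zero]) h
    ext m n
    exact eq_zero_of_antidiagonal (fun m n => sub_eq_zero.1 (congrFun₂ h' m n)) (K - m)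
      (hK _ (by omega) _)

end Products

/-! ## Reconstruction of a vertex superalgebra from generating fields -/

section Reconstruction

variable {M : Type*} [AddCommGroup M] [Module ℂ M]

theorem homogeneous_induction {grading : ZMod 2 → Submodule ℂ M}
    (hi : DirectSum.IsInternal grading) {P : M → Prop} (hadd : ∀ x y, P x → P y → P (x + y))
    (hP : ∀ i, ∀ x ∈ grading i, P x) (x : M) : P x := by
  have hx : x ∈ ⨆ i, grading i := by rw [hi.submodule_iSup_eq_top]; trivial
  exact Submodule.iSup_induction grading (motive := P) hx hP (hP 0 0 (zero_mem _)) hadd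

/-- A family of mutually local creative series, whose iterated application to the vacuum vector
spans the space. -/
structure IsGeneratingFamily (grading : ZMod 2 → Submodule ℂ M) (vac : M) (D : Module.End ℂ M)
    (X : ZMod 2 → Set (FormalSeries M)) : Prop where
  isInternal : DirectSum.IsInternal grading
  vac_mem : vac ∈ grading 0
  D_vac : D vac = 0
  creative : ∀ i, ∀ a ∈ X i, IsCreative grading vac D i a
  mem_localTo : ∀ i j, ∀ a ∈ X i, ∀ b ∈ X j, b ∈ localTo (superSign i j) a
  generation : ∀ S : ZMod 2 → Submodule ℂ M, vac ∈ S 0 →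
    (∀ i j, ∀ a ∈ X i, ∀ n : ℤ, ∀ w ∈ S j, a n w ∈ S (i + j)) → ∀ j, grading j ≤ S j

variable {grading : ZMod 2 → Submodule ℂ M} {vac : M} {D : Module.End ℂ M}
  {X : ZMod 2 → Set (FormalSeries M)}

/-- The creative series of parity `i` which are local to the series of the family `X`. -/
def fieldSpace (grading : ZMod 2 → Submodule ℂ M) (vac : M) (D : Module.End ℂ M)
    (X : ZMod 2 → Set (FormalSeries M)) (i : ZMod 2) : Submodule ℂ (FormalSeries M) where
  carrier := {a | IsCreative grading vac D i a ∧ ∀ j, ∀ c ∈ X j, a ∈ localTo (superSign j i) c}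
  zero_mem' := by
    refine ⟨⟨fun n j w _ => zero_mem _, fun w => ⟨0, fun n _ => rfl⟩, fun n => by simp,
      fun n _ => rfl⟩, fun j c _ => zero_mem _⟩
  add_mem' := by
    rintro a b ⟨ha, ha'⟩ ⟨hb, hb'⟩
    refine ⟨⟨fun n j w hw => add_mem (ha.homogeneous n j w hw) (hb.homogeneous n j w hw),
      fun w => ?_, fun n => ?_, fun n hn => ?_⟩, fun j c hc => add_mem (ha' j c hc) (hb' j c hc)⟩
    · obtain ⟨N, hN⟩ := ha.truncation w
      obtain ⟨N', hN'⟩ := hb.truncation w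
      refine ⟨max N N', fun n hn => ?_⟩
      rw [Pi.add_apply, LinearMap.add_apply, hN n (le_trans (le_max_left _ _) hn),
        hN' n (le_trans (le_max_right _ _) hn), add_zero]
    · rw [Pi.add_apply, Pi.add_apply, smul_add, ← ha.derivation, ← hb.derivation, mul_add,
        add_mul]
      abel
    · rw [Pi.add_apply, LinearMap.add_apply, ha.creation n hn, hb.creation n hn, add_zero]
  smul_mem' := by
    rintro c a ⟨ha, ha'⟩
    refine ⟨⟨fun n j w hw => Submodule.smul_mem _ _ (ha.homogeneous n j w hw),
      fun w => ?_, fun n => ?_, fun n hn => ?_⟩,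
      fun j d hd => Submodule.smul_mem _ _ (ha' j d hd)⟩
    · obtain ⟨N, hN⟩ := ha.truncation w
      exact ⟨N, fun n hn => by rw [Pi.smul_apply, LinearMap.smul_apply, hN n hn, smul_zero]⟩
    · rw [Pi.smul_apply, Pi.smul_apply, smul_comm, ← ha.derivation, mul_smul_comm,
        smul_mul_assoc, smul_sub]
    · rw [Pi.smul_apply, LinearMap.smul_apply, ha.creation n hn, smul_zero]

/-- The state `a₋₁ 1` of a series `a(z)`. -/
def state (vac : M) : FormalSeries M →ₗ[ℂ] M where
  toFun a := a (-1) vac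
  map_add' _ _ := rfl
  map_smul' _ _ := rfl

theorem state_apply (a : FormalSeries M) : state vac a = a (-1) vac := rfl

theorem IsCreative.state_mem {i : ZMod 2} {a : FormalSeries M}
    (ha : IsCreative grading vac D i a) (hvac : vac ∈ grading 0) : state vac a ∈ grading i := by
  simpa [state_apply] using ha.homogeneous (-1) 0 vac hvac

theorem fieldSpace_nprod {i j : ZMod 2} {a b : FormalSeries M}
    (ha : a ∈ fieldSpace grading vac D X i) (hb : b ∈ fieldSpace grading vac D X j)
    (hab : b ∈ localTo (superSign i j) a) (k : ℤ) :
    nprod (superSign i j) ha.1.truncation hb.1.truncation k ∈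
      fieldSpace grading vac D X (i + j) := by
  refine ⟨ha.1.nprod hb.1 _ k, fun l c hc => ?_⟩
  rw [superSign_add_right]
  exact nprod_mem_localTo _ _ hab (ha.2 l c hc) (hb.2 l c hc) k

/-! ### The state-field correspondence -/

namespace IsGeneratingFamily

variable (h : IsGeneratingFamily grading vac D X)

include h

theorem subset_fieldSpace {i : ZMod 2} {a : FormalSeries M} (ha : a ∈ X i) :
    a ∈ fieldSpace grading vac D X i :=
  ⟨h.creative i a ha, fun j c hc => h.mem_localTo j i c hc a ha⟩

/-- Goddard's uniqueness theorem. -/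
theorem eq_zero_of_state_eq_zero {i : ZMod 2} {a : FormalSeries M}
    (ha : a ∈ fieldSpace grading vac D X i) (h0 : state vac a = 0) : a = 0 := by
  have hvac : ∀ n, a n vac = 0 := by
    -- Since `D 1 = 0`, one has `D aₙ 1 = -n aₙ₋₁ 1`; so `a(z) 1` is determined by its constant
    -- term.
    have hneg : ∀ n : ℕ, a (-1 - (n : ℤ)) vac = 0 := by
      intro n
      induction n with
      | zero => simpa [state_apply] using h0
      | succ n ih =>
        have hd := LinearMap.congr_fun (ha.1.derivation (-1 - (n : ℤ))) vac
        rw [LinearMap.sub_apply, Module.End.mul_apply, Module.End.mul_apply, ih, h.D_vac, map_zero,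
          map_zero, sub_zero, LinearMap.smul_apply] at hd
        have hne : -((-1 - (n : ℤ) : ℤ) : ℂ) ≠ 0 := by
          rw [neg_ne_zero, Int.cast_ne_zero]
          omega
        rw [Nat.cast_succ, ← sub_sub]
        exact (smul_eq_zero.1 hd.symm).resolve_left hne
    intro n
    by_cases hn : 0 ≤ n
    · exact ha.1.creation n hn
    · have := hneg (-1 - n).toNat
      rwa [Int.toNat_of_nonneg (by omega), sub_sub_cancel] at this
  have hS := h.generation (fun _ => ⨅ n, LinearMap.ker (a n))
    (by simpa [Submodule.mem_iInf] using hvac) (by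
      intro j l c hc m w hw
      simp only [Submodule.mem_iInf, LinearMap.mem_ker] at hw ⊢
      obtain ⟨N, hN⟩ := ha.2 j c hc
      obtain ⟨K, hK⟩ := (h.creative j c hc).truncation w
      -- The joint kernel of the modes of `a` is stable under the generators: as `a(z₂) w = 0`,
      -- locality reads `(z₁ - z₂)^N a(z₂) c(z₁) w = 0`, and `c(z₁) w` is truncated, so the power
      -- cancels.
      have hg : (fun m n => a n (c m w)) = 0 := by
        refine eq_zero_of_mulDiff_pow (K := K) (fun m hm n => by rw [hK m hm, map_zero])
          (N := N) ?_
        have e : (fun m n => a n (c m w)) = -superSign j i •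
            fun m n => LinearMap.applyₗ w (superComm (superSign j i) c a m n) := by
          ext m n
          simp [superComm_apply, hw, smul_smul, superSign_mul_self]
        rw [e, map_smul]
        ext m n
        rw [Pi.smul_apply, Pi.smul_apply, mulDiff_pow_map, hN]
        simp
      exact fun n => congrFun₂ hg m n)
  ext n w
  refine homogeneous_induction h.isInternal (P := fun w => a n w = 0)
    (fun x y hx hy => by rw [map_add, hx, hy, add_zero]) (fun j x hx => ?_) w
  have := hS j hx
  simp only [Submodule.mem_iInf, LinearMap.mem_ker] at this
  exact this n

theorem eq_of_state_eq {i : ZMod 2} {a b : FormalSeries M}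
    (ha : a ∈ fieldSpace grading vac D X i) (hb : b ∈ fieldSpace grading vac D X i)
    (hab : state vac a = state vac b) : a = b :=
  sub_eq_zero.1 (h.eq_zero_of_state_eq_zero (sub_mem ha hb) (by rw [map_sub, hab, sub_self]))

/-- The states of series local both to `X` and to `c` contain the vacuum (identity series) and are
stable under modes of `X`, by Dong's lemma and `IsCreative.nprod_vac`. The extra series `c` is
carried along so that `fieldSpace_mem_localTo` can follow. -/
theorem exists_local_field {k : ZMod 2} {c : FormalSeries M}
    (hc : ∀ i, ∀ a ∈ X i, a ∈ localTo (superSign k i) c) {i : ZMod 2} {v : M}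
    (hv : v ∈ grading i) :
    ∃ b ∈ fieldSpace grading vac D X i, b ∈ localTo (superSign k i) c ∧ state vac b = v := by
  have hS := h.generation (fun i => Submodule.map (state vac)
    (fieldSpace grading vac D X i ⊓ localTo (superSign k i) c)) ?_ ?_ i hv
  · obtain ⟨b, hb, rfl⟩ := hS
    exact ⟨b, hb.1, hb.2, rfl⟩
  · refine ⟨idSeries, ⟨⟨isCreative_idSeries, fun j d _ => ?_⟩, ?_⟩, ?_⟩
    · rw [superSign_zero_right]
      exact idSeries_mem_localTo d
    · rw [superSign_zero_right]
      exact idSeries_mem_localTo c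
    · simp [state_apply, idSeries]
  · rintro i j a ha n _ ⟨b, ⟨hb, hbc⟩, rfl⟩
    have ha' := h.subset_fieldSpace ha
    refine ⟨_, ⟨fieldSpace_nprod ha' hb (hb.2 i a ha) n, ?_⟩, ha'.1.nprod_vac hb.1 _ n⟩
    rw [superSign_add_right]
    exact nprod_mem_localTo _ _ (hb.2 i a ha) (hc i a ha) hbc n

theorem exists_field {i : ZMod 2} {v : M} (hv : v ∈ grading i) :
    ∃ b ∈ fieldSpace grading vac D X i, state vac b = v := by
  -- Every series is local to `0`, so the extra condition becomes void.
  obtain ⟨b, hb, -, hbv⟩ := h.exists_local_field (k := 0) (c := 0)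
    (fun i a _ => ⟨0, by ext; simp [superComm]⟩) hv
  exact ⟨b, hb, hbv⟩

/-- Some series with the same state as `b` is local to `a`; by Goddard uniqueness it is `b` itself.
-/
theorem fieldSpace_mem_localTo {i j : ZMod 2} {a b : FormalSeries M}
    (ha : a ∈ fieldSpace grading vac D X i) (hb : b ∈ fieldSpace grading vac D X j) :
    b ∈ localTo (superSign i j) a := by
  obtain ⟨b', hb', hloc, hs⟩ := h.exists_local_field (k := i) (c := a) (fun l c hc => by
    rw [superSign_comm]
    exact localTo_symm (superSign_mul_self _ _) (ha.2 l c hc)) (hb.1.state_mem h.vac_mem)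
  rwa [h.eq_of_state_eq hb' hb hs] at hloc

/-- The bijection between the creative local series of parity `i` and their states. -/
def fieldEquiv (i : ZMod 2) : fieldSpace grading vac D X i ≃ₗ[ℂ] grading i :=
  LinearEquiv.ofBijective
    (((state vac).comp (fieldSpace grading vac D X i).subtype).codRestrict (grading i)
      fun a => a.2.1.state_mem h.vac_mem)
    ⟨fun a b hab => Subtype.ext (h.eq_of_state_eq a.2 b.2 (congrArg Subtype.val hab)),
      fun v => by
        obtain ⟨b, hb, hbv⟩ := h.exists_field v.2
        exact ⟨⟨b, hb⟩, Subtype.ext hbv⟩⟩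

theorem bijective_coeLinearMap : Function.Bijective (DirectSum.coeLinearMap grading) :=
  h.isInternal

/-- The state-field correspondence. -/
def fieldMap : M →ₗ[ℂ] FormalSeries M :=
  (DirectSum.toModule ℂ (ZMod 2) (FormalSeries M) fun i =>
    (fieldSpace grading vac D X i).subtype ∘ₗ (h.fieldEquiv i).symm.toLinearMap) ∘ₗ
    (LinearEquiv.ofBijective (DirectSum.coeLinearMap grading)
      h.bijective_coeLinearMap).symm.toLinearMap

theorem fieldMap_of_mem {i : ZMod 2} {v : M} (hv : v ∈ grading i) :
    h.fieldMap v = ((h.fieldEquiv i).symm ⟨v, hv⟩ : FormalSeries M) := by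
  have e : (LinearEquiv.ofBijective (DirectSum.coeLinearMap grading)
      h.bijective_coeLinearMap).symm v =
      DirectSum.lof ℂ (ZMod 2) (fun i => grading i) i ⟨v, hv⟩ := by
    rw [LinearEquiv.symm_apply_eq, LinearEquiv.ofBijective_apply, DirectSum.coeLinearMap_lof]
  rw [fieldMap, LinearMap.comp_apply, LinearEquiv.coe_coe, e, DirectSum.toModule_lof]
  rfl

theorem fieldMap_mem {i : ZMod 2} {v : M} (hv : v ∈ grading i) :
    h.fieldMap v ∈ fieldSpace grading vac D X i := by
  rw [h.fieldMap_of_mem hv]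
  exact Subtype.property _

theorem fieldMap_vac {i : ZMod 2} {v : M} (hv : v ∈ grading i) : h.fieldMap v (-1) vac = v := by
  rw [h.fieldMap_of_mem hv]
  exact congrArg Subtype.val ((h.fieldEquiv i).apply_symm_apply ⟨v, hv⟩)

theorem fieldMap_state {i : ZMod 2} {a : FormalSeries M}
    (ha : a ∈ fieldSpace grading vac D X i) : h.fieldMap (a (-1) vac) = a :=
  have hv := ha.1.state_mem h.vac_mem
  h.eq_of_state_eq (h.fieldMap_mem hv) ha (h.fieldMap_vac hv)

/-- Both sides lie in the field space, the right one by Dong's lemma, and have the same state. -/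
theorem fieldMap_apply {i j : ZMod 2} {u v : M} (hu : u ∈ grading i) (hv : v ∈ grading j)
    (k : ℤ) : h.fieldMap (h.fieldMap u k v) = nprod (superSign i j)
      (h.fieldMap_mem hu).1.truncation (h.fieldMap_mem hv).1.truncation k := by
  have ha := h.fieldMap_mem hu
  have hb := h.fieldMap_mem hv
  rw [← h.fieldMap_state (fieldSpace_nprod ha hb (h.fieldSpace_mem_localTo ha hb) k),
    ha.1.nprod_vac hb.1, h.fieldMap_vac hv]

theorem fieldMap_D (u : M) : h.fieldMap (D u) = derivative (h.fieldMap u) := by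
  refine homogeneous_induction h.isInternal (P := fun u => h.fieldMap (D u) = derivative (h.fieldMap u))
    (fun x y hx hy => ?_) (fun i u hu => ?_) u
  · rw [map_add, map_add, map_add, hx, hy]
    ext n : 1
    simp only [derivative_apply, Pi.add_apply, smul_add]
  · have ha := h.fieldMap_mem hu
    have hd : derivative (h.fieldMap u) ∈ fieldSpace grading vac D X i :=
      ⟨ha.1.derivative, fun j c hc => derivative_mem_localTo (ha.2 j c hc)⟩
    rw [← h.fieldMap_state hd]
    congr 1
    rw [derivative_apply, ← ha.1.derivation, LinearMap.sub_apply, Module.End.mul_apply,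
      Module.End.mul_apply, h.D_vac, map_zero, sub_zero, h.fieldMap_vac hu]

theorem isVertexSuperalgebra_fieldMap :
    IsVertexSuperalgebra grading vac D h.fieldMap where
  isInternal := h.isInternal
  truncation u v := by
    refine homogeneous_induction h.isInternal (P := fun u => ∃ N : ℤ, ∀ n ≥ N, h.fieldMap u n v = 0)
      ?_ (fun i u hu => (h.fieldMap_mem hu).1.truncation v) u
    rintro x y ⟨N, hN⟩ ⟨N', hN'⟩
    refine ⟨max N N', fun n hn => ?_⟩
    rw [map_add, Pi.add_apply, LinearMap.add_apply, hN n (le_trans (le_max_left _ _) hn),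
      hN' n (le_trans (le_max_right _ _) hn), add_zero]
  derivation_commutator u n := by
    rw [h.fieldMap_D, derivative_apply]
    refine homogeneous_induction h.isInternal (P := fun u => D * h.fieldMap u n - h.fieldMap u n * D =
      -(n : ℂ) • h.fieldMap u (n - 1)) (fun x y hx hy => ?_)
      (fun i u hu => (h.fieldMap_mem hu).1.derivation n) u
    rw [map_add, Pi.add_apply, Pi.add_apply, smul_add, ← hx, ← hy, mul_add, add_mul]
    abel
  derivation_deriv u n := by rw [h.fieldMap_D, derivative_apply]
  vacuum n := by
    have hid : idSeries ∈ fieldSpace grading vac D X 0 :=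
      ⟨isCreative_idSeries, fun j c _ => by
        rw [superSign_zero_right]
        exact idSeries_mem_localTo c⟩
    have := h.fieldMap_state hid
    rw [show idSeries (-1) vac = vac by simp [idSeries]] at this
    rw [this]
    rfl
  creation_regular u n hn := by
    refine homogeneous_induction h.isInternal (P := fun u => h.fieldMap u n vac = 0)
      (fun x y hx hy => ?_) (fun i u hu => (h.fieldMap_mem hu).1.creation n hn) u
    rw [map_add, Pi.add_apply, LinearMap.add_apply, hx, hy, add_zero]
  creation_limit u := by
    refine homogeneous_induction h.isInternal (P := fun u => h.fieldMap u (-1) vac = u)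
      (fun x y hx hy => ?_) (fun i u hu => h.fieldMap_vac hu) u
    rw [map_add, Pi.add_apply, LinearMap.add_apply, hx, hy]
  jacobi i j u hu v hv w k m n := by
    have ha := h.fieldMap_mem hu
    have hb := h.fieldMap_mem hv
    rw [← jacobiLeft_eq_finsum ha.1.truncation hb.1.truncation,
      jacobiLeft_eq_finsum_nprod _ _ (h.fieldSpace_mem_localTo ha hb)]
    simp only [h.fieldMap_apply hu hv]
  parity i j u hu v hv n := (h.fieldMap_mem hu).1.homogeneous n j v hv

/-- For uniqueness: the Jacobi identity makes every field of a competing structure local to the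
generators, so Goddard's theorem applies to it. -/
theorem mem_fieldSpace_of_isVertexSuperalgebra {Y : M →ₗ[ℂ] FormalSeries M}
    (hY : IsVertexSuperalgebra grading vac D Y) (hX : ∀ i, ∀ a ∈ X i, Y (a (-1) vac) = a)
    {i : ZMod 2} {v : M} (hv : v ∈ grading i) : Y v ∈ fieldSpace grading vac D X i := by
  refine ⟨⟨fun n j w hw => hY.parity i j v hv w hw n, hY.truncation v, fun n => ?_,
    hY.creation_regular v⟩, fun j c hc => ?_⟩
  · rw [hY.derivation_commutator, hY.derivation_deriv]
  · have hcv := (h.creative j c hc).state_mem h.vac_mem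
    obtain ⟨N, hN⟩ := hY.truncation (state vac c) v
    have h1 : IsTruncated (Y (c (-1) vac)) := hY.truncation _
    have h2 : IsTruncated (Y v) := hY.truncation _
    have hJ := hY.jacobi j i _ hcv v hv
    rw [← hX j c hc]
    -- With `k = N.toNat` every product on the right of the Jacobi identity has index at least `N`
    -- and vanishes; the left is then `(z₁ - z₂)^k` times the supercommutator.
    refine ⟨N.toNat, ?_⟩
    ext m n w
    rw [← jacobiLeft_natCast h1 h2, jacobiLeft_eq_finsum]
    refine (hJ w _ m n).trans (finsum_eq_zero_of_forall_eq_zero fun l => ?_)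
    rw [hN _ (by omega)]
    simp

/-- The reconstruction theorem. -/
theorem exists_unique_vertexSuperalgebra :
    ∃ Y : M →ₗ[ℂ] FormalSeries M, IsVertexSuperalgebra grading vac D Y ∧
      (∀ i, ∀ a ∈ X i, Y (a (-1) vac) = a) ∧
      generatedBy grading vac D Y {w | ∃ i, ∃ a ∈ X i, w = a (-1) vac} = ⊤ ∧
      ∀ Y' : M →ₗ[ℂ] FormalSeries M, IsVertexSuperalgebra grading vac D Y' →
        (∀ i, ∀ a ∈ X i, Y' (a (-1) vac) = a) → Y' = Y := by
  refine ⟨h.fieldMap, h.isVertexSuperalgebra_fieldMap,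
    fun i a ha => h.fieldMap_state (h.subset_fieldSpace ha), ?_, fun Y' hY' hX => ?_⟩
  · refine eq_top_iff.2 (le_sInf ?_)
    -- Closure of `S` under products includes closure under the modes of the generating series, so
    -- `S` exhausts the space.
    rintro S ⟨hS, hXS⟩ w -
    have hgen := h.generation (fun _ => S) hS.vac_mem fun i j a ha n w hw => by
      have := hS.mul_mem _ (hXS ⟨i, a, ha, rfl⟩) w hw n
      rwa [h.fieldMap_state (h.subset_fieldSpace ha)] at this
    exact homogeneous_induction h.isInternal (P := (· ∈ S)) (fun _ _ => add_mem)
      (fun i x hx => hgen i hx) w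
  · refine LinearMap.ext fun v => ?_
    refine homogeneous_induction h.isInternal (P := fun v => Y' v = h.fieldMap v)
      (fun x y hx hy => by rw [map_add, map_add, hx, hy]) (fun i v hv => ?_) v
    refine h.eq_of_state_eq (h.mem_fieldSpace_of_isVertexSuperalgebra hY' hX hv)
      (h.fieldMap_mem hv) ?_
    rw [state_apply, state_apply, hY'.creation_limit, h.fieldMap_vac hv]

end IsGeneratingFamily
end Reconstruction

/-! ### Gradings as eigenspace decompositions -/

section ParityInvolution

variable {M : Type*} [AddCommGroup M] [Module ℂ M]

/-- The operator acting on the component of parity `i` as `(-1)^i`. -/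
def parityInvolution {grading : ZMod 2 → Submodule ℂ M} (hi : DirectSum.IsInternal grading) :
    Module.End ℂ M :=
  (DirectSum.toModule ℂ (ZMod 2) M fun i => (-1 : ℂ) ^ i.val • (grading i).subtype) ∘ₗ
    (LinearEquiv.ofBijective (DirectSum.coeLinearMap grading)
      (show Function.Bijective _ from hi)).symm.toLinearMap

theorem parityInvolution_of_mem {grading : ZMod 2 → Submodule ℂ M}
    (hi : DirectSum.IsInternal grading) {i : ZMod 2} {v : M} (hv : v ∈ grading i) :
    parityInvolution hi v = (-1 : ℂ) ^ i.val • v := by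
  have hb : Function.Bijective (DirectSum.coeLinearMap grading) := hi
  have e : (LinearEquiv.ofBijective (DirectSum.coeLinearMap grading) hb).symm v =
      DirectSum.lof ℂ (ZMod 2) (fun i => grading i) i ⟨v, hv⟩ := by
    rw [LinearEquiv.symm_apply_eq, LinearEquiv.ofBijective_apply, DirectSum.coeLinearMap_lof]
  rw [parityInvolution, LinearMap.comp_apply, LinearEquiv.coe_coe, e, DirectSum.toModule_lof]
  rfl

theorem neg_one_pow_val_add (i j : ZMod 2) :
    (-1 : ℂ) ^ (i + j).val = (-1 : ℂ) ^ i.val * (-1 : ℂ) ^ j.val := by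
  rw [ZMod.val_add, ← neg_one_pow_eq_pow_mod_two, pow_add]

/-- A decomposition into eigenspaces of a parity operator is direct. -/
theorem isInternal_of_parity {grading : ZMod 2 → Submodule ℂ M} (σ : Module.End ℂ M)
    (hσ : ∀ i, ∀ v ∈ grading i, σ v = (-1 : ℂ) ^ i.val • v) (htop : ⨆ i, grading i = ⊤) :
    DirectSum.IsInternal grading := by
  have huniv : (Set.univ : Set (ZMod 2)) = {0, 1} := by
    refine Set.ext fun i => ⟨fun _ => ?_, fun _ => Set.mem_univ i⟩
    revert i
    decide
  rw [DirectSum.isInternal_submodule_iff_isCompl grading zero_ne_one huniv]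
  refine ⟨Submodule.disjoint_def.2 fun v h0 h1 => ?_, codisjoint_iff.2 ?_⟩
  -- A vector in both parts satisfies `v = -v`.
  · have e := (hσ 0 v h0).symm.trans (hσ 1 v h1)
    have h2 : (2 : ℂ) • v = 0 := by
      rw [show (1 : ZMod 2).val = 1 from rfl, ZMod.val_zero] at e
      rw [two_smul]
      nth_rw 1 [← one_smul ℂ v, ← pow_zero (-1 : ℂ), e]
      simp
    exact (smul_eq_zero.1 h2).resolve_left two_ne_zero
  · rw [eq_top_iff, ← htop, iSup_le_iff]
    intro i
    rcases (show i ∈ ({0, 1} : Set (ZMod 2)) from huniv ▸ Set.mem_univ i) with rfl | rfl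
    exacts [le_sup_left, le_sup_right]

end ParityInvolution

namespace VertexLieSuperalgebra

variable {U : Type*} [AddCommGroup U] [Module ℂ U] (A : VertexLieSuperalgebra U)

/-! ## The parity operator of the generalized Verma module -/

/-- The parity operator of a vertex Lie superalgebra. -/
def sigma : Module.End ℂ U := parityInvolution A.isInternal

theorem sigma_of_mem {i : ZMod 2} {u : U} (hu : u ∈ A.grading i) :
    A.sigma u = (-1 : ℂ) ^ i.val • u := parityInvolution_of_mem A.isInternal hu

theorem sigma_D (u : U) : A.sigma (A.D u) = A.D (A.sigma u) := by
  refine homogeneous_induction A.isInternal (P := fun u => A.sigma (A.D u) = A.D (A.sigma u))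
    (fun x y hx hy => by simp only [map_add, hx, hy]) (fun i u hu => ?_) u
  rw [A.sigma_of_mem hu, A.sigma_of_mem (A.D_even i u hu), map_smul]

/-- The parity operator of `ℒ(U)`. -/
def locSigma : Module.End ℂ A.Loc :=
  A.locLift (fun n => A.mode n ∘ₗ A.sigma) fun u n => by
    simp [A.sigma_D, A.mode_D]

theorem locSigma_mode (n : ℤ) (u : U) : A.locSigma (A.mode n u) = A.mode n (A.sigma u) :=
  A.locLift_mode _ _ n u

theorem locSigma_of_mem {i : ZMod 2} {x : A.Loc} (hx : x ∈ A.locGrading i) :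
    A.locSigma x = (-1 : ℂ) ^ i.val • x := by
  have h : A.locGrading i ≤ LinearMap.eqLocus A.locSigma ((-1 : ℂ) ^ i.val • LinearMap.id) := by
    refine Submodule.span_le.2 ?_
    rintro _ ⟨u, hu, n, rfl⟩
    simp [LinearMap.mem_eqLocus, A.locSigma_mode, A.sigma_of_mem hu]
  exact h hx

theorem mode_mem {i : ZMod 2} {u : U} (hu : u ∈ A.grading i) (n : ℤ) :
    A.mode n u ∈ A.locGrading i := Submodule.subset_span ⟨u, hu, n, rfl⟩

theorem bracket_mem {i j : ZMod 2} {x y : A.Loc} (hx : x ∈ A.locGrading i)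
    (hy : y ∈ A.locGrading j) : A.bracket x y ∈ A.locGrading (i + j) := by
  have h1 : ∀ u ∈ A.grading i, ∀ n, A.locGrading j ≤
      (A.locGrading (i + j)).comap (A.bracket (A.mode n u)) := by
    intro u hu n
    refine Submodule.span_le.2 ?_
    rintro _ ⟨v, hv, p, rfl⟩
    rw [SetLike.mem_coe, Submodule.mem_comap, A.bracket_mode]
    exact finsum_mem_submodule _ fun l => Submodule.smul_mem _ _
      (A.mode_mem (A.parity i j u hu v hv l) _)
  have h2 : A.locGrading i ≤ (A.locGrading (i + j)).comap (A.bracket.flip y) := by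
    refine Submodule.span_le.2 ?_
    rintro _ ⟨u, hu, n, rfl⟩
    exact h1 u hu n hy
  exact h2 hx

/-- The parity automorphism of the universal enveloping algebra of `ℒ(U)`. -/
def envSigma : A.Env →ₐ[ℂ] A.Env :=
  RingQuot.liftAlgHom ℂ ⟨TensorAlgebra.lift ℂ
    (Enveloping.ι A.locGrading A.bracket ∘ₗ A.locSigma), by
      rintro _ _ ⟨i, j, x, y, hx, hy⟩
      simp only [map_mul, map_add, map_smul, TensorAlgebra.lift_ι_apply, LinearMap.comp_apply,
        A.locSigma_of_mem hx, A.locSigma_of_mem hy, A.locSigma_of_mem (A.bracket_mem hx hy),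
        neg_one_pow_val_add, smul_mul_smul_comm, Enveloping.ι_mul_ι hx hy]
      module⟩

theorem envSigma_ι (x : A.Loc) : A.envSigma (Enveloping.ι A.locGrading A.bracket x) =
    Enveloping.ι A.locGrading A.bracket (A.locSigma x) := by
  simp [envSigma, Enveloping.ι]

theorem envSigma_of_mem {i : ZMod 2} {a : A.Env}
    (ha : a ∈ Enveloping.parityPart A.locGrading A.bracket i) :
    A.envSigma a = (-1 : ℂ) ^ i.val • a := by
  have key : ∀ l : List (ZMod 2 × A.Loc), (∀ p ∈ l, p.2 ∈ A.locGrading p.1) →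
      A.envSigma (l.map fun p => Enveloping.ι A.locGrading A.bracket p.2).prod =
        (-1 : ℂ) ^ (l.map Prod.fst).sum.val •
          (l.map fun p => Enveloping.ι A.locGrading A.bracket p.2).prod := by
    intro l
    induction l with
    | nil => intro _; simp
    | cons p l ih =>
      intro hl
      rw [List.map_cons, List.map_cons, List.prod_cons, List.sum_cons, map_mul,
        ih fun q hq => hl q (List.mem_cons_of_mem _ hq), envSigma_ι,
        A.locSigma_of_mem (hl p List.mem_cons_self), map_smul, smul_mul_smul_comm,
        neg_one_pow_val_add]
  have h : Enveloping.parityPart A.locGrading A.bracket i ≤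
      LinearMap.eqLocus A.envSigma.toLinearMap ((-1 : ℂ) ^ i.val • LinearMap.id) := by
    refine Submodule.span_le.2 ?_
    rintro _ ⟨l, hl, rfl, rfl⟩
    exact key l hl
  exact h ha

theorem envSigma_mem {a : A.Env} (ha : a ∈ A.leftIdeal) : A.envSigma a ∈ A.leftIdeal := by
  refine Submodule.span_induction ?_ (by simp) (fun x y _ _ hx hy => ?_)
    (fun b x _ hx => ?_) ha
  · rintro _ ⟨u, n, hn, rfl⟩
    exact Submodule.subset_span ⟨A.sigma u, n, hn, by rw [envSigma_ι, locSigma_mode]⟩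
  · rw [map_add]; exact add_mem hx hy
  · rw [smul_eq_mul, map_mul]
    exact A.leftIdeal.smul_mem _ hx

/-- The parity operator of `𝒱(U)`. -/
def vermaSigma : Module.End ℂ A.Verma :=
  (A.leftIdeal.restrictScalars ℂ).mapQ (A.leftIdeal.restrictScalars ℂ)
    A.envSigma.toLinearMap fun _ => A.envSigma_mem

theorem vermaSigma_of_mem {i : ZMod 2} {w : A.Verma} (hw : w ∈ A.vermaGrading i) :
    A.vermaSigma w = (-1 : ℂ) ^ i.val • w := by
  obtain ⟨a, ha, rfl⟩ := hw
  rw [← map_smul, ← A.envSigma_of_mem ha]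
  rfl

theorem ι_mul_mem_parityPart {i j : ZMod 2} {x : A.Loc} {a : A.Env} (hx : x ∈ A.locGrading i)
    (ha : a ∈ Enveloping.parityPart A.locGrading A.bracket j) :
    Enveloping.ι A.locGrading A.bracket x * a ∈
      Enveloping.parityPart A.locGrading A.bracket (i + j) := by
  have h : Enveloping.parityPart A.locGrading A.bracket j ≤
      (Enveloping.parityPart A.locGrading A.bracket (i + j)).comap
        (LinearMap.mulLeft ℂ (Enveloping.ι A.locGrading A.bracket x)) := by
    refine Submodule.span_le.2 ?_
    rintro _ ⟨l, hl, rfl, rfl⟩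
    refine Submodule.subset_span ⟨(i, x) :: l, ?_, by simp, by simp⟩
    intro p hp
    rcases List.mem_cons.1 hp with rfl | hp
    exacts [hx, hl p hp]
  exact h ha

theorem one_mem_parityPart : (1 : A.Env) ∈ Enveloping.parityPart A.locGrading A.bracket 0 :=
  Submodule.subset_span ⟨[], by simp, by simp, by simp⟩

theorem iSup_parityPart : ⨆ i, Enveloping.parityPart A.locGrading A.bracket i = ⊤ := by
  set T := ⨆ i, Enveloping.parityPart A.locGrading A.bracket i with hT
  have hle : ∀ i, Enveloping.parityPart A.locGrading A.bracket i ≤ T := le_iSup _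
  have hmode : ∀ (n : ℤ) (u : U), ∀ b ∈ T,
      Enveloping.ι A.locGrading A.bracket (A.mode n u) * b ∈ T := by
    intro n u b hb
    refine homogeneous_induction A.isInternal (P := fun u =>
      Enveloping.ι A.locGrading A.bracket (A.mode n u) * b ∈ T) (fun x y hx hy => ?_)
      (fun i u hu => ?_) u
    · rw [map_add, map_add, add_mul]; exact add_mem hx hy
    · have h : T ≤ T.comap
          (LinearMap.mulLeft ℂ (Enveloping.ι A.locGrading A.bracket (A.mode n u))) :=
        iSup_le fun j a ha => hle _ (A.ι_mul_mem_parityPart (A.mode_mem hu n) ha)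
      exact h hb
  have hι : ∀ x : A.Loc, ∀ b ∈ T, Enveloping.ι A.locGrading A.bracket x * b ∈ T := by
    intro x b hb
    refine A.loc_induction (P := fun x => Enveloping.ι A.locGrading A.bracket x * b ∈ T)
      (by simp) (fun x y hx hy => ?_) (fun n u => hmode n u b hb) x
    rw [map_add, add_mul]; exact add_mem hx hy
  have key : ∀ t : TensorAlgebra ℂ A.Loc, ∀ b ∈ T,
      RingQuot.mkAlgHom ℂ (EnvelopingRel A.locGrading A.bracket) t * b ∈ T := by
    intro t
    induction t using TensorAlgebra.induction with
    | algebraMap r =>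
      intro b hb
      rw [AlgHom.commutes, ← Algebra.smul_def]
      exact T.smul_mem r hb
    | ι x => exact hι x
    | mul s t hs ht => intro b hb; rw [map_mul, mul_assoc]; exact hs _ (ht b hb)
    | add s t hs ht => intro b hb; rw [map_add, add_mul]; exact add_mem (hs b hb) (ht b hb)
  rw [eq_top_iff]
  rintro a -
  obtain ⟨t, rfl⟩ := RingQuot.mkAlgHom_surjective ℂ (EnvelopingRel A.locGrading A.bracket) a
  simpa using key t 1 (hle 0 A.one_mem_parityPart)

theorem vermaMk_surjective : Function.Surjective A.vermaMk := A.leftIdeal.mkQ_surjective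

/-- Parity on `U` extends to an algebra automorphism of the enveloping algebra that preserves the
left ideal. The graded parts lie in different eigenspaces of the induced operator, hence are
independent, without a basis of `𝒱(U)`. -/
theorem isInternal_vermaGrading : DirectSum.IsInternal A.vermaGrading := by
  refine isInternal_of_parity A.vermaSigma (fun i w hw => A.vermaSigma_of_mem hw) ?_
  have h : ⨆ i, A.vermaGrading i =
      (⨆ i, Enveloping.parityPart A.locGrading A.bracket i).map A.vermaMk :=
    (Submodule.map_iSup _ _).symm
  rw [h, A.iSup_parityPart, Submodule.map_top, LinearMap.range_eq_top]
  exact A.vermaMk_surjective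

/-! ## The fields of the generalized Verma module -/

theorem vermaField_mk (u : U) (n : ℤ) (a : A.Env) : A.vermaField u n (A.vermaMk a) =
    A.vermaMk (Enveloping.ι A.locGrading A.bracket (A.mode n u) * a) := rfl

theorem vermaD_mk (a : A.Env) : A.vermaD (A.vermaMk a) = A.vermaMk (A.envD a) := rfl

theorem vermaField_vac (u : U) : A.vermaField u (-1) A.vermaVac = A.kappa u := by
  rw [vermaVac, vermaField_mk, mul_one]
  rfl

/-- The action of the universal enveloping algebra of `ℒ(U)` on `𝒱(U)`. -/
def vermaRep : A.Env →ₐ[ℂ] Module.End ℂ A.Verma := Algebra.lsmul ℂ ℂ A.Verma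

theorem vermaRep_mk (a b : A.Env) : A.vermaRep a (A.vermaMk b) = A.vermaMk (a * b) := rfl

theorem vermaField_eq (u : U) (n : ℤ) : A.vermaField u n =
    A.vermaRep (Enveloping.ι A.locGrading A.bracket (A.mode n u)) := rfl

theorem vermaField_add (u v : U) : A.vermaField (u + v) = A.vermaField u + A.vermaField v := by
  funext n
  rw [Pi.add_apply, vermaField_eq, map_add, map_add, map_add]
  rfl

theorem vermaD_commutator (a : A.Env) :
    A.vermaD * A.vermaRep a - A.vermaRep a * A.vermaD = A.vermaRep (A.envD a) := by
  refine LinearMap.ext fun w => ?_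
  obtain ⟨b, rfl⟩ := A.vermaMk_surjective w
  rw [LinearMap.sub_apply, Module.End.mul_apply, Module.End.mul_apply, vermaRep_mk, vermaD_mk,
    vermaD_mk, vermaRep_mk, vermaRep_mk, envD, Enveloping.derivation_mul, map_add,
    add_sub_cancel_right]

theorem vermaVac_mem : A.vermaVac ∈ A.vermaGrading 0 := ⟨1, A.one_mem_parityPart, rfl⟩

theorem vermaD_vac : A.vermaD A.vermaVac = 0 := by
  have h := Enveloping.derivation_mul A.locD A.locD_even A.locD_bracket 1 1
  rw [mul_one, mul_one, one_mul, left_eq_add] at h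
  rw [vermaVac, vermaD_mk, envD, h, map_zero]

/-- `𝒱(U)` is cyclic over the enveloping algebra, with parities tracked; this supplies the
generation axiom and the inductions over `𝒱(U)`. -/
theorem vermaGrading_le (S : ZMod 2 → Submodule ℂ A.Verma) (h0 : A.vermaVac ∈ S 0)
    (hS : ∀ i j, ∀ u ∈ A.grading i, ∀ n : ℤ, ∀ w ∈ S j, A.vermaField u n w ∈ S (i + j))
    (j : ZMod 2) : A.vermaGrading j ≤ S j := by
  have hcons : ∀ i j, ∀ x ∈ A.locGrading i, ∀ a : A.Env, A.vermaMk a ∈ S j →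
      A.vermaMk (Enveloping.ι A.locGrading A.bracket x * a) ∈ S (i + j) := by
    intro i j x hx a ha
    have h : A.locGrading i ≤ (S (i + j)).comap (A.vermaMk ∘ₗ LinearMap.mulRight ℂ a ∘ₗ
        Enveloping.ι A.locGrading A.bracket) := by
      refine Submodule.span_le.2 ?_
      rintro _ ⟨u, hu, n, rfl⟩
      exact hS i j u hu n _ ha
    exact h hx
  have key : ∀ l : List (ZMod 2 × A.Loc), (∀ p ∈ l, p.2 ∈ A.locGrading p.1) →
      A.vermaMk (l.map fun p => Enveloping.ι A.locGrading A.bracket p.2).prod ∈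
        S (l.map Prod.fst).sum := by
    intro l
    induction l with
    | nil => intro _; exact h0
    | cons p l ih =>
      intro hl
      exact hcons _ _ _ (hl p List.mem_cons_self) _
        (ih fun q hq => hl q (List.mem_cons_of_mem _ hq))
  rw [vermaGrading, Submodule.map_le_iff_le_comap]
  refine Submodule.span_le.2 ?_
  rintro _ ⟨l, hl, rfl, rfl⟩
  exact key l hl

/-- The commutator formula for the fields of `𝒱(U)`. -/
theorem superComm_vermaField {i j : ZMod 2} {u v : U} (hu : u ∈ A.grading i)
    (hv : v ∈ A.grading j) {N : ℕ} (hN : ∀ l ≥ N, A.Y u l v = 0) (m n : ℤ) :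
    superComm (superSign i j) (A.vermaField u) (A.vermaField v) m n =
      ∑ l ∈ Finset.range N, ((Ring.choose m l : ℤ) : ℂ) •
        A.vermaField (A.Y u l v) (m + n - l) := by
  simp only [superComm, vermaField_eq]
  rw [← map_mul A.vermaRep, ← map_mul A.vermaRep, Enveloping.ι_mul_ι (A.mode_mem hu m) (A.mode_mem hv n), map_add,
    map_smul, add_sub_cancel_left, A.bracket_mode, show (∑ᶠ l : ℕ, ((Ring.choose m l : ℤ) : ℂ) •
      A.mode (m + n - l) (A.Y u l v)) = A.modeBracket u v m n from rfl, A.modeBracket_eq hN]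
  simp only [map_sum, map_smul]

/-- These are, up to normalization, the coefficients of `f` times the `l`-th derivative of the delta
function. Each factor `z₁ - z₂` lowers `l` by one, and the last one kills the delta function. -/
theorem mulDiff_pow_choose {E : Type*} [AddCommGroup E] [Module ℂ E] (l : ℕ) (f : ℤ → E) :
    (mulDiff ^ (l + 1)) (fun m n : ℤ => ((Ring.choose m l : ℤ) : ℂ) • f (m + n - l)) = 0 := by
  induction l with
  | zero =>
    ext m n
    simp only [zero_add, pow_one, mulDiff_apply, Ring.choose_zero_right]
    rw [show m + 1 + n = m + (n + 1) by ring, sub_self]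
    rfl
  | succ l ih =>
    rw [pow_succ, Module.End.mul_apply, ← ih]
    congr 1
    ext m n
    rw [mulDiff_apply, show m + 1 + n = m + (n + 1) by ring, Ring.choose_succ_succ, ← sub_smul,
      Int.cast_add, add_sub_cancel_right,
      show m + (n + 1) - ((l + 1 : ℕ) : ℤ) = m + n - l by push_cast; ring]

theorem vermaField_mem_localTo {i j : ZMod 2} {u v : U} (hu : u ∈ A.grading i)
    (hv : v ∈ A.grading j) : A.vermaField v ∈ localTo (superSign i j) (A.vermaField u) := by
  obtain ⟨N, hN⟩ := A.truncation u v
  refine ⟨N, ?_⟩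
  have e : superComm (superSign i j) (A.vermaField u) (A.vermaField v) =
      ∑ l ∈ Finset.range N, fun m n : ℤ => ((Ring.choose m l : ℤ) : ℂ) •
        A.vermaField (A.Y u l v) (m + n - l) := by
    ext m n : 2
    rw [A.superComm_vermaField hu hv hN, Finset.sum_apply, Finset.sum_apply]
  rw [e, map_sum]
  refine Finset.sum_eq_zero fun l hl => ?_
  exact mulDiff_pow_eq_zero_of_le (mulDiff_pow_choose l _) (Finset.mem_range.1 hl)

theorem isTruncated_vermaField {i : ZMod 2} {u : U} (hu : u ∈ A.grading i) :
    IsTruncated (A.vermaField u) := by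
  -- Quantifying over all homogeneous `u` at once is needed: moving a mode of `u` past one of `v`
  -- produces modes of the vectors `u_l v`.
  let S : Submodule ℂ A.Verma :=
    { carrier := {w | ∀ i, ∀ u ∈ A.grading i,
        ∀ᶠ n : ℤ in Filter.atTop, A.vermaField u n w = 0}
      zero_mem' := fun i u _ => by simp
      add_mem' := fun {w w'} hw hw' i u hu => by
        filter_upwards [hw i u hu, hw' i u hu] with n h1 h2
        rw [map_add, h1, h2, add_zero]
      smul_mem' := fun c w hw i u hu => by
        filter_upwards [hw i u hu] with n h1
        rw [map_smul, h1]
        exact (LinearMap.lsmul ℂ A.Verma c).map_zero }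
  have hS := A.vermaGrading_le (fun _ => S) (fun i u _ => by
    filter_upwards [Filter.eventually_ge_atTop 0] with n hn
    rw [vermaVac, vermaField_mk, mul_one]
    exact (Submodule.Quotient.mk_eq_zero A.leftIdeal).2
      (Submodule.subset_span ⟨u, n, hn, rfl⟩)) (by
    intro j l v hv p w hw i u hu
    obtain ⟨N, hN⟩ := A.truncation u v
    have h : ∀ᶠ n : ℤ in Filter.atTop, ∀ l ∈ Finset.range N,
        A.vermaField (A.Y u l v) (n + p - l) w = 0 := by
      rw [Filter.eventually_all_finset]
      intro l _
      obtain ⟨K, hK⟩ := Filter.eventually_atTop.1 (hw _ _ (A.parity i j u hu v hv l))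
      filter_upwards [Filter.eventually_ge_atTop (K - p + l)] with n hn
      exact hK _ (by omega)
    filter_upwards [h, hw i u hu] with n h1 h2
    -- For large `n` the term `v_p u_n w` vanishes, and `u_n v_p w` reduces to finitely many
    -- commutator terms with index tending to infinity.
    have hc := LinearMap.congr_fun (A.superComm_vermaField hu hv hN n p) w
    rw [superComm_apply, h2, map_zero, smul_zero, sub_zero] at hc
    rw [hc, LinearMap.sum_apply]
    refine Finset.sum_eq_zero fun l hl => ?_
    rw [LinearMap.smul_apply, h1 l hl, smul_zero])
  intro w
  refine Filter.eventually_atTop.1 ?_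
  exact homogeneous_induction A.isInternal_vermaGrading (P := (· ∈ S)) (fun _ _ => add_mem)
    (fun j x hx => hS j hx) w i u hu

theorem isCreative_vermaField {i : ZMod 2} {u : U} (hu : u ∈ A.grading i) :
    IsCreative A.vermaGrading A.vermaVac A.vermaD i (A.vermaField u) where
  homogeneous n j w hw := by
    obtain ⟨a, ha, rfl⟩ := hw
    exact ⟨_, A.ι_mul_mem_parityPart (A.mode_mem hu n) ha, rfl⟩
  truncation := A.isTruncated_vermaField hu
  derivation n := by
    rw [vermaField_eq, vermaD_commutator, envD, Enveloping.derivation_ι, A.locD_mode, A.mode_D,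
      map_smul, map_smul]
    rfl
  creation n hn := by
    rw [vermaVac, vermaField_mk, mul_one]
    exact (Submodule.Quotient.mk_eq_zero A.leftIdeal).2
      (Submodule.subset_span ⟨u, n, hn, rfl⟩)

theorem isGeneratingFamily_vermaField : IsGeneratingFamily A.vermaGrading A.vermaVac A.vermaD
    fun i => {a | ∃ u ∈ A.grading i, a = A.vermaField u} where
  isInternal := A.isInternal_vermaGrading
  vac_mem := A.vermaVac_mem
  D_vac := A.vermaD_vac
  creative := by
    rintro i _ ⟨u, hu, rfl⟩
    exact A.isCreative_vermaField hu
  mem_localTo := by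
    rintro i j _ ⟨u, hu, rfl⟩ _ ⟨v, hv, rfl⟩
    exact A.vermaField_mem_localTo hu hv
  generation S h0 hS :=
    A.vermaGrading_le S h0 fun i j u hu n w hw => hS i j _ ⟨u, hu, rfl⟩ n w hw

end VertexLieSuperalgebra

end VertexLie

end

/-! ### Reconstruction applied to the generalized Verma module -/

theorem theorem5p3 {U : Type*} [AddCommGroup U] [Module ℂ U]
    (A : VertexLie.VertexLieSuperalgebra U) :
    -- the fields of homogeneous vectors are vertex operators, local to each other
    (∀ i : ZMod 2, ∀ u ∈ A.grading i,
      VertexLie.IsVertexOperator A.vermaGrading A.vermaD i (A.vermaField u)) ∧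
    (∀ i j : ZMod 2, ∀ u ∈ A.grading i, ∀ v ∈ A.grading j,
      VertexLie.MutuallyLocal i j (A.vermaField u) (A.vermaField v)) ∧
    -- there is exactly one vertex superalgebra structure with these fields, and they generate it
    ∃ Y : A.Verma →ₗ[ℂ] VertexLie.FormalSeries A.Verma,
      VertexLie.IsVertexSuperalgebra A.vermaGrading A.vermaVac A.vermaD Y ∧
      (∀ u : U, Y (A.kappa u) = A.vermaField u) ∧
      VertexLie.generatedBy A.vermaGrading A.vermaVac A.vermaD Y
        {w | ∃ i : ZMod 2, ∃ u ∈ A.grading i, w = A.kappa u} = ⊤ ∧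
      ∀ Y' : A.Verma →ₗ[ℂ] VertexLie.FormalSeries A.Verma,
        VertexLie.IsVertexSuperalgebra A.vermaGrading A.vermaVac A.vermaD Y' →
        (∀ u : U, Y' (A.kappa u) = A.vermaField u) → Y' = Y := by
  have hloc : ∀ i j : ZMod 2, ∀ u ∈ A.grading i, ∀ v ∈ A.grading j,
      VertexLie.MutuallyLocal i j (A.vermaField u) (A.vermaField v) := fun i j u hu v hv =>
    VertexLie.mutuallyLocal_iff.2 (A.vermaField_mem_localTo hu hv)
  refine ⟨fun i u hu => ?_, hloc, ?_⟩
  · have h := A.isCreative_vermaField hu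
    exact ⟨h.homogeneous, h.truncation, hloc i i u hu u hu, h.derivation⟩
  obtain ⟨Y, hY, hX, hgen, huniq⟩ :=
    A.isGeneratingFamily_vermaField.exists_unique_vertexSuperalgebra
  refine ⟨Y, hY, fun u => ?_, ?_, fun Y' hY' hX' => huniq Y' hY' ?_⟩
  · refine VertexLie.homogeneous_induction A.isInternal
      (P := fun u => Y (A.kappa u) = A.vermaField u) (fun x y hx hy => ?_) (fun i u hu => ?_) u
    · rw [map_add, map_add, hx, hy, A.vermaField_add]
    · rw [← A.vermaField_vac]
      exact hX i _ ⟨u, hu, rfl⟩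
  · rw [← hgen]
    congr 1
    ext w
    constructor
    · rintro ⟨i, u, hu, rfl⟩
      exact ⟨i, _, ⟨u, hu, rfl⟩, (A.vermaField_vac u).symm⟩
    · rintro ⟨i, _, ⟨u, hu, rfl⟩, rfl⟩
      exact ⟨i, u, hu, A.vermaField_vac u⟩
  · rintro i _ ⟨u, hu, rfl⟩
    rw [A.vermaField_vac]
    exact hX' u
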